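/- **Theorem (eigenvector phase transition, rank-one additive perturbation).** For every $n\ge 1$ let $X_n$ and $P_n$ be independent $n\times n$ random matrices, all defined on one probability space, which are either real symmetric for all $n$ or complex Hermitian for all $n$. Assume that for each $n$ the law of $X_n$ or the law of $P_n$ is invariant under conjugation by every orthogonal matrix (real symmetric case), respectively by every unitary matrix (complex Hermitian case). Assume that: - almost surely, the empirical eigenvalue distribution $\mu_{X_n}=\frac1n\sum_{j=1}^n\delta_{\lambda_j(X_n)}$ converges weakly, as $n\to\infty$, to a non-random compactly supported probability measure $\mu_X$ on $\mathbb{R}$; - with $a$ and $b$ the infimum and the supremum of the support of $\mu_X$, the smallest and the largest eigenvalue of $X_n$ converge almost surely to $a$ and to $b$ respectively; - $P_n$ has rank $1$, and its only non-zero eigenvalue is a deterministic real number $\theta\neq 0$ that does not depend on $n$. Let $G_{\mu_X}(z)=\int\frac{1}{z-t}\,\mathrm{d}\mu_X(t)$ be the Cauchy transform of $\mu_X$, and write $f(c^+)=\lim_{z\downarrow c}f(z)$ and $f(c^-)=\lim_{z\uparrow c}f(z)$ for one-sided limits in $[-\infty,+\infty]$. Suppose that $$\frac1\theta\notin\bigl(G_{\mu_X}(a^-),\,G_{\mu_X}(b^+)\bigr)\quad\text{and}\quad\begin{cases}G_{\mu_X}'(b^+)=-\infty&\text{if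 }\theta>0,\\ G_{\mu_X}'(a^-)=-\infty&\text{if }\theta<0.\end{cases}$$ For each $n$ let $\widetilde u_n$ be a unit-norm eigenvector of $X_n+P_n$ associated with its largest eigenvalue if $\theta>0$, and with its smallest eigenvalue if $\theta<0$. Then, almost surely, the norm of the orthogonal projection of $\widetilde u_n$ onto $\ker(\theta I_n-P_n)$ tends to $0$ as $n\to\infty$. -/

import Mathlib

open MeasureTheory ProbabilityTheory Filter Topology

noncomputable section

namespace SpikedModel

/-- The largest eigenvalue of a Hermitian matrix. -/
def largestEigenvalue {𝕜 : Type*} [RCLike 𝕜] {ι : Type*} [Fintype ι] [DecidableEq ι] [Nonempty ι]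
    {A : Matrix ι ι 𝕜} (hA : A.IsHermitian) : ℝ :=
  Finset.univ.sup' Finset.univ_nonempty hA.eigenvalues

/-- The smallest eigenvalue of a Hermitian matrix. -/
def smallestEigenvalue {𝕜 : Type*} [RCLike 𝕜] {ι : Type*} [Fintype ι] [DecidableEq ι] [Nonempty ι]
    {A : Matrix ι ι 𝕜} (hA : A.IsHermitian) : ℝ :=
  Finset.univ.inf' Finset.univ_nonempty hA.eigenvalues

/-- The empirical eigenvalue distribution of a Hermitian matrix: each eigenvalue, counted with
multiplicity, carries mass one over the size of the matrix. -/
def empiricalSpectralMeasure {𝕜 : Type*} [RCLike 𝕜] {ι : Type*} [Fintype ι] [DecidableEq ι]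
    [Nonempty ι] {A : Matrix ι ι 𝕜} (hA : A.IsHermitian) : ProbabilityMeasure ℝ :=
  ⟨(Fintype.card ι : ENNReal)⁻¹ • ∑ i, Measure.dirac (hA.eigenvalues i), ⟨by
    simp only [Measure.smul_apply, Measure.coe_finsetSum, Finset.sum_apply, measure_univ,
      Finset.sum_const, Finset.card_univ, nsmul_eq_mul, mul_one, smul_eq_mul]
    exact ENNReal.inv_mul_cancel (by simp) (by simp)⟩⟩

/-- The Cauchy transform `z ↦ ∫ 1 / (z - t) dμ(t)` on the real axis (used off the support of `μ`). -/
def cauchyTransform (μ : Measure ℝ) (z : ℝ) : ℝ := ∫ t, 1 / (z - t) ∂μ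

/-- Matrices carry the entrywise (product) measurable structure. -/
instance instMeasurableSpaceMatrix {ι κ R : Type*} [MeasurableSpace R] :
    MeasurableSpace (Matrix ι κ R) :=
  MeasurableSpace.pi

/-- The law of the random matrix `A` is invariant under conjugation by the unitary group of `𝕜`:
orthogonal invariance if `𝕜 = ℝ`, unitary invariance if `𝕜 = ℂ`. -/
def IsConjInvariant {𝕜 : Type*} [RCLike 𝕜] {ι : Type*} [Fintype ι] [DecidableEq ι]
    {Ω : Type*} [MeasurableSpace Ω] (Pr : Measure Ω) (A : Ω → Matrix ι ι 𝕜) : Prop :=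
  ∀ U ∈ Matrix.unitaryGroup ι 𝕜, Pr.map (fun ω => U * A ω * star U) = Pr.map A

/-- The eigenspace `ker (θ I - A)` as a subspace of Euclidean space. -/
def kerSub {𝕜 : Type*} [RCLike 𝕜] {ι : Type*} [Fintype ι] [DecidableEq ι]
    (θ : ℝ) (A : Matrix ι ι 𝕜) : Submodule 𝕜 (EuclideanSpace 𝕜 ι) :=
  LinearMap.ker (Matrix.toEuclideanLin ((θ : 𝕜) • (1 : Matrix ι ι 𝕜) - A))

/-- `⟨x, F⟩`: the norm of the orthogonal projection of `x` onto the subspace `F`. -/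
def projNorm {𝕜 : Type*} [RCLike 𝕜] {ι : Type*} [Fintype ι]
    (x : EuclideanSpace 𝕜 ι) (F : Submodule 𝕜 (EuclideanSpace 𝕜 ι)) : ℝ :=
  ‖F.orthogonalProjectionOnto x‖

/-- `x` is a unit-norm eigenvector of `A` for the real eigenvalue `l`. -/
def IsUnitEigenvector {𝕜 : Type*} [RCLike 𝕜] {ι : Type*} [Fintype ι] [DecidableEq ι]
    (A : Matrix ι ι 𝕜) (l : ℝ) (x : EuclideanSpace 𝕜 ι) : Prop :=
  ‖x‖ = 1 ∧ Matrix.toEuclideanLin A x = (l : 𝕜) • x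

end SpikedModel

end

/-!
Conjugation invariance allows averaging over a Haar-distributed unitary `U`.  Integration by parts
along the rotations of coordinate planes shows that the fourth central moment of `⟨Uv, f(X) Uv⟩` is
`O(n⁻²)` for bounded `f`; this is summable, so almost surely `⟨v, f(Xₙ) v⟩ → ∫ f dμ`, where
`Pₙ = θ v v*`.  Let `θ > 0`.  An eigenvalue `L` of `Xₙ + Pₙ` off the spectrum of `Xₙ` satisfies the
secular equation `θ ⟨v, (L - Xₙ)⁻¹ v⟩ = 1`, and `θ G(z) < 1` for all `z > b`, so the top eigenvalue
is eventually below every such `z`.  Its unit eigenvector `u` then satisfies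
`θ² |⟨v, u⟩|² ⟨v, (z - Xₙ)⁻² v⟩ ≤ 1`, where the last factor tends to `-G'(z)`, which is arbitrarily
large as `z ↓ b`.  The case `θ < 0` follows by replacing `(X, P)` with `(-X, -P)`.
-/

namespace SpikedModel

open Matrix

instance instBorelSpaceMatrix {ι κ R : Type*} [Countable ι] [Countable κ] [TopologicalSpace R]
    [MeasurableSpace R] [SecondCountableTopology R] [BorelSpace R] : BorelSpace (Matrix ι κ R) :=
  inferInstanceAs (BorelSpace (ι → κ → R))

instance instSecondCountableTopologyMatrix {ι κ R : Type*} [Countable ι] [Countable κ]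
    [TopologicalSpace R] [SecondCountableTopology R] :
    SecondCountableTopology (Matrix ι κ R) :=
  inferInstanceAs (SecondCountableTopology (ι → κ → R))

section Haar

variable {𝕜 : Type*} [RCLike 𝕜] {ι : Type*} [Fintype ι] [DecidableEq ι]

instance instCompactSpaceUnitaryGroup : CompactSpace (unitaryGroup ι 𝕜) := by
  refine isCompact_iff_compactSpace.mp (IsCompact.of_isClosed_subset
    (isCompact_univ_pi fun _ => isCompact_univ_pi fun _ => isCompact_closedBall (0 : 𝕜) 1) ?_
    fun A hA i _ j _ => mem_closedBall_zero_iff.2 (entry_norm_bound_of_unitary hA i j))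
  have h_eq : (unitaryGroup ι 𝕜 : Set (Matrix ι ι 𝕜)) = {A | star A * A = 1} :=
    Set.ext fun A => mem_unitaryGroup_iff'
  rw [h_eq]
  exact isClosed_eq (by fun_prop) continuous_const

/-- The normalized Haar measure of the unitary group. -/
noncomputable def unitaryHaar (ι 𝕜 : Type*) [RCLike 𝕜] [Fintype ι] [DecidableEq ι] :
    Measure (unitaryGroup ι 𝕜) :=
  Measure.haarMeasure ⊤

instance instIsProbabilityMeasureUnitaryHaar : IsProbabilityMeasure (unitaryHaar ι 𝕜) :=
  ⟨Measure.haarMeasure_self (K₀ := (⊤ : TopologicalSpace.PositiveCompacts (unitaryGroup ι 𝕜)))⟩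

instance instIsMulLeftInvariantUnitaryHaar : (unitaryHaar ι 𝕜).IsMulLeftInvariant :=
  inferInstanceAs (Measure.haarMeasure _).IsMulLeftInvariant

theorem integral_unitaryHaar_mulVec (φ : (ι → 𝕜) → ℝ) (V : unitaryGroup ι 𝕜) (v : ι → 𝕜) :
    ∫ U, φ (V.1 *ᵥ (U.1 *ᵥ v)) ∂(unitaryHaar ι 𝕜) = ∫ U, φ (U.1 *ᵥ v) ∂(unitaryHaar ι 𝕜) := by
  rw [← integral_mul_left_eq_self (fun U : unitaryGroup ι 𝕜 => φ (U.1 *ᵥ v)) V]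
  simp only [Submonoid.coe_mul, mulVec_mulVec]

theorem integrable_unitaryHaar {φ : unitaryGroup ι 𝕜 → ℝ} (hφ : Continuous φ) :
    Integrable φ (unitaryHaar ι 𝕜) :=
  hφ.integrable_of_hasCompactSupport (HasCompactSupport.of_compactSpace _)

theorem sum_norm_sq_mulVec (U : unitaryGroup ι 𝕜) (v : ι → 𝕜) :
    ∑ i, ‖(U.1 *ᵥ v) i‖ ^ 2 = ∑ i, ‖v i‖ ^ 2 := by
  have h_dot (x : ι → 𝕜) : ((∑ i, ‖x i‖ ^ 2 : ℝ) : 𝕜) = star x ⬝ᵥ x := by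
    simp [dotProduct, RCLike.conj_mul]
  apply RCLike.ofReal_injective (K := 𝕜)
  rw [h_dot, h_dot, star_mulVec, dotProduct_mulVec, vecMul_vecMul, ← star_eq_conjTranspose,
    mem_unitaryGroup_iff'.1 U.2, vecMul_one]

theorem exp_smul_mem_unitaryGroup {K : Matrix ι ι 𝕜} (hK : K ∈ skewAdjoint (Matrix ι ι 𝕜))
    (t : ℝ) : NormedSpace.exp (t • K) ∈ unitaryGroup ι 𝕜 := by
  have h_star : star (t • K) = -(t • K) := skewAdjoint.mem_iff.1 (skewAdjoint.smul_mem t hK)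
  rw [mem_unitaryGroup_iff', star_eq_conjTranspose, ← exp_conjTranspose, ← star_eq_conjTranspose,
    h_star, ← exp_add_of_commute _ _ (Commute.refl (t • K)).neg_left, neg_add_cancel,
    NormedSpace.exp_zero]

section

open scoped Norms.Operator

theorem hasDerivAt_exp_smul_mulVec (K : Matrix ι ι 𝕜) (x : ι → 𝕜) (t : ℝ) :
    HasDerivAt (fun s : ℝ => NormedSpace.exp (s • K) *ᵥ x)
      (K *ᵥ (NormedSpace.exp (t • K) *ᵥ x)) t := by
  rw [mulVec_mulVec]
  let evalAt : Matrix ι ι 𝕜 →L[ℝ] (ι → 𝕜) :=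
    LinearMap.toContinuousLinearMap ((mulVecBilin ℝ ℝ).flip x)
  exact evalAt.hasFDerivAt.comp_hasDerivAt t (hasDerivAt_exp_smul_const' K t)

end

theorem integral_fderiv_skewAdjoint_eq_zero {K : Matrix ι ι 𝕜}
    (hK : K ∈ skewAdjoint (Matrix ι ι 𝕜)) {φ : (ι → 𝕜) → ℝ} (hφ : ContDiff ℝ 1 φ) (v : ι → 𝕜) :
    ∫ U, fderiv ℝ φ (U.1 *ᵥ v) (K *ᵥ (U.1 *ᵥ v)) ∂(unitaryHaar ι 𝕜) = 0 := by
  let R (t : ℝ) : unitaryGroup ι 𝕜 := ⟨NormedSpace.exp (t • K), exp_smul_mem_unitaryGroup hK t⟩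
  let ψ (x : ι → 𝕜) : ℝ := fderiv ℝ φ x (K *ᵥ x)
  have hψ : Continuous ψ := by
    have := hφ.continuous_fderiv one_ne_zero
    fun_prop
  obtain ⟨C, hC⟩ := isCompact_univ.exists_bound_of_continuousOn
    (f := fun U : unitaryGroup ι 𝕜 => ψ (U.1 *ᵥ v)) (by fun_prop)
  have h_deriv (U : unitaryGroup ι 𝕜) (t : ℝ) :
      HasDerivAt (fun s => φ ((R s).1 *ᵥ (U.1 *ᵥ v))) (ψ ((R t).1 *ᵥ (U.1 *ᵥ v))) t :=
    (hφ.differentiable one_ne_zero _).hasFDerivAt.comp_hasDerivAt t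
      (hasDerivAt_exp_smul_mulVec K (U.1 *ᵥ v) t)
  have h_main := (hasDerivAt_integral_of_dominated_loc_of_deriv_le (μ := unitaryHaar ι 𝕜)
    (bound := fun _ => C) (F := fun s U => φ ((R s).1 *ᵥ (U.1 *ᵥ v)))
    (F' := fun t U => ψ ((R t).1 *ᵥ (U.1 *ᵥ v))) (x₀ := 0) univ_mem
    (.of_forall fun s => (integrable_unitaryHaar (by have := hφ.continuous; fun_prop)).1)
    (integrable_unitaryHaar (by have := hφ.continuous; fun_prop))
    (integrable_unitaryHaar (by fun_prop)).1
    (.of_forall fun U t _ => by simpa [mulVec_mulVec] using hC (R t * U) trivial)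
    (integrable_const C) (.of_forall fun U t _ => h_deriv U t)).2
  simp only [integral_unitaryHaar_mulVec φ, integral_unitaryHaar_mulVec ψ] at h_main
  exact h_main.unique (hasDerivAt_const _ _)

end Haar

section Concentration

variable {𝕜 : Type*} [RCLike 𝕜] {ι : Type*}

/-- The generator of the rotations of the plane of the coordinates `i` and `j`. -/
def rotationGenerator (𝕜 : Type*) [RCLike 𝕜] [DecidableEq ι] (i j : ι) : Matrix ι ι 𝕜 :=
  single i j 1 - single j i 1

theorem rotationGenerator_mem_skewAdjoint [DecidableEq ι] (i j : ι) :
    rotationGenerator 𝕜 i j ∈ skewAdjoint (Matrix ι ι 𝕜) := by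
  simp [rotationGenerator, skewAdjoint.mem_iff, star_eq_conjTranspose]

variable [Fintype ι]

theorem rotationGenerator_mulVec [DecidableEq ι] (i j : ι) (x : ι → 𝕜) :
    rotationGenerator 𝕜 i j *ᵥ x = Pi.single i (x j) - Pi.single j (x i) := by
  simp [rotationGenerator, sub_mulVec, single_mulVec, Pi.single]

/-- The diagonal quadratic form `∑ cᵢ |xᵢ|²`, centred at its mean over the unit sphere. -/
noncomputable def centeredForm (c : ι → ℝ) (x : ι → 𝕜) : ℝ :=
  ∑ i, c i * ‖x i‖ ^ 2 - (∑ i, c i) / Fintype.card ι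

theorem contDiff_centeredForm (c : ι → ℝ) : ContDiff ℝ 1 (centeredForm (𝕜 := 𝕜) c) := by
  have (i : ι) : ContDiff ℝ 1 fun x : ι → 𝕜 => ‖x i‖ ^ 2 := (contDiff_apply ℝ 𝕜 i).norm_sq ℝ
  unfold centeredForm
  fun_prop

theorem hasFDerivAt_centeredForm (c : ι → ℝ) (x : ι → 𝕜) :
    HasFDerivAt (centeredForm c)
      (∑ i, c i • (2 • (innerSL ℝ (x i)).comp (ContinuousLinearMap.proj (R := ℝ) i))) x :=
  (HasFDerivAt.fun_sum fun i _ => ((hasFDerivAt_apply i x).norm_sq).const_mul (c i)).sub_const _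

theorem fderiv_inner_mul_centeredForm_pow [DecidableEq ι] (c : ι → ℝ) (i j : ι) (k : ℕ)
    (x : ι → 𝕜) :
    fderiv ℝ (fun x : ι → 𝕜 => inner ℝ (x i) (x j) * centeredForm c x ^ (k + 1)) x
        (rotationGenerator 𝕜 i j *ᵥ x) =
      2 * (k + 1) * (c i - c j) * (inner ℝ (x i) (x j) ^ 2 * centeredForm c x ^ k) -
        (‖x i‖ ^ 2 - ‖x j‖ ^ 2) * centeredForm c x ^ (k + 1) := by
  have h_inner := (hasFDerivAt_apply (𝕜 := ℝ) i x).inner ℝ (hasFDerivAt_apply j x)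
  rw [(h_inner.fun_mul ((hasFDerivAt_centeredForm c x).pow (k + 1))).fderiv,
    rotationGenerator_mulVec]
  rcases eq_or_ne i j with rfl | hij
  · simp
  have h_single (l m : ι) (z : 𝕜) : inner ℝ (x m) (Pi.single (M := fun _ => 𝕜) l z m) =
      if m = l then inner ℝ (x m) z else 0 := by
    split_ifs with h <;> simp [h]
  simp only [add_tsub_cancel_right, nsmul_eq_mul, Nat.cast_add, Nat.cast_one, Nat.cast_ofNat,
    _root_.add_apply, _root_.smul_apply, _root_.sum_apply, ContinuousLinearMap.comp_apply,
    ContinuousLinearMap.proj_apply, ContinuousLinearMap.prod_apply, fderivInnerCLM_apply,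
    coe_innerSL_apply, Pi.sub_apply, Pi.single_eq_same, Pi.single_eq_of_ne, ne_eq, hij, hij.symm,
    not_false_eq_true, inner_sub_right, inner_neg_right, inner_self_eq_norm_sq_to_K,
    Real.ringHom_apply, real_inner_comm, h_single, smul_eq_mul, mul_sub, mul_ite, mul_zero,
    sub_zero, zero_sub, Finset.sum_sub_distrib, Finset.sum_ite_eq', Finset.mem_univ, ↓reduceIte]
  ring

/-- Integration by parts along the rotations of the plane of the coordinates `i` and `j`. -/
theorem integral_sub_mul_centeredForm_pow [DecidableEq ι] (c : ι → ℝ) (v : ι → 𝕜) (i j : ι)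
    (k : ℕ) :
    ∫ U, (‖(U.1 *ᵥ v) i‖ ^ 2 - ‖(U.1 *ᵥ v) j‖ ^ 2) * centeredForm c (U.1 *ᵥ v) ^ (k + 1)
        ∂(unitaryHaar ι 𝕜) =
      2 * (k + 1) * (c i - c j) * ∫ U, inner ℝ ((U.1 *ᵥ v) i) ((U.1 *ᵥ v) j) ^ 2 *
        centeredForm c (U.1 *ᵥ v) ^ k ∂(unitaryHaar ι 𝕜) := by
  have h_cont := (contDiff_centeredForm (𝕜 := 𝕜) c).continuous
  have h_zero := integral_fderiv_skewAdjoint_eq_zero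
    (φ := fun x : ι → 𝕜 => inner ℝ (x i) (x j) * centeredForm c x ^ (k + 1))
    (rotationGenerator_mem_skewAdjoint i j)
    (((contDiff_apply ℝ 𝕜 i).inner ℝ (contDiff_apply ℝ 𝕜 j)).mul
      ((contDiff_centeredForm c).pow (k + 1))) v
  simp only [fderiv_inner_mul_centeredForm_pow] at h_zero
  rw [integral_sub, integral_const_mul, sub_eq_zero] at h_zero
  exacts [h_zero.symm, integrable_unitaryHaar (by fun_prop), integrable_unitaryHaar (by fun_prop)]

theorem sum_sub_mul_norm_sq_sub_norm_sq [Nonempty ι] (c : ι → ℝ) {x : ι → 𝕜}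
    (hx : ∑ i, ‖x i‖ ^ 2 = 1) :
    ∑ i, ∑ j, (c i - c j) * (‖x i‖ ^ 2 - ‖x j‖ ^ 2) =
      2 * Fintype.card ι * centeredForm c x := by
  simp only [sub_mul, mul_sub, Finset.sum_sub_distrib, ← Finset.mul_sum, ← Finset.sum_mul, hx,
    Finset.sum_const, Finset.card_univ, nsmul_eq_mul, centeredForm,
    mul_left_comm (c _)]
  field_simp
  ring

theorem sum_sq_sub_mul_inner_sq_le {c : ι → ℝ} {Δ : ℝ} (hc : ∀ i j, |c i - c j| ≤ Δ)
    {x : ι → 𝕜} (hx : ∑ i, ‖x i‖ ^ 2 = 1) :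
    ∑ i, ∑ j, (c i - c j) ^ 2 * inner ℝ (x i) (x j) ^ 2 ≤ Δ ^ 2 := by
  calc ∑ i, ∑ j, (c i - c j) ^ 2 * inner ℝ (x i) (x j) ^ 2
      ≤ ∑ i, ∑ j, Δ ^ 2 * (‖x i‖ ^ 2 * ‖x j‖ ^ 2) := by
        refine Finset.sum_le_sum fun i _ => Finset.sum_le_sum fun j _ => ?_
        rw [← mul_pow ‖x i‖, ← sq_abs (c i - c j), ← sq_abs (inner ℝ _ _)]
        gcongr
        exacts [hc i j, abs_real_inner_le_norm _ _]
    _ = Δ ^ 2 := by simp only [← Finset.mul_sum, hx, mul_one]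

variable [DecidableEq ι] [Nonempty ι]

theorem card_mul_integral_centeredForm_pow_le {c : ι → ℝ} {Δ : ℝ} (hc : ∀ i j, |c i - c j| ≤ Δ)
    {v : ι → 𝕜} (hv : ∑ i, ‖v i‖ ^ 2 = 1) {k : ℕ} (hk : Even k) :
    Fintype.card ι * ∫ U, centeredForm c (U.1 *ᵥ v) ^ (k + 2) ∂(unitaryHaar ι 𝕜) ≤
      (k + 1) * Δ ^ 2 * ∫ U, centeredForm c (U.1 *ᵥ v) ^ k ∂(unitaryHaar ι 𝕜) := by
  have h_cont := (contDiff_centeredForm (𝕜 := 𝕜) c).continuous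
  have h_unit (U : unitaryGroup ι 𝕜) : ∑ i, ‖(U.1 *ᵥ v) i‖ ^ 2 = 1 := by
    rw [sum_norm_sq_mulVec, hv]
  have h_parts : ∫ U, 2 * (Fintype.card ι) * centeredForm c (U.1 *ᵥ v) ^ (k + 2)
      ∂(unitaryHaar ι 𝕜) = 2 * (k + 1) * ∫ U, (∑ i, ∑ j, (c i - c j) ^ 2 *
        inner ℝ ((U.1 *ᵥ v) i) ((U.1 *ᵥ v) j) ^ 2) * centeredForm c (U.1 *ᵥ v) ^ k
      ∂(unitaryHaar ι 𝕜) := by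
    have h_expand (U : unitaryGroup ι 𝕜) :
        2 * (Fintype.card ι) * centeredForm c (U.1 *ᵥ v) ^ (k + 2) = ∑ i, ∑ j, (c i - c j) *
          ((‖(U.1 *ᵥ v) i‖ ^ 2 - ‖(U.1 *ᵥ v) j‖ ^ 2) * centeredForm c (U.1 *ᵥ v) ^ (k + 1)) := by
      simp only [← mul_assoc, ← Finset.sum_mul, sum_sub_mul_norm_sq_sub_norm_sq c (h_unit U)]
      ring
    simp only [h_expand, Finset.sum_mul]
    rw [integral_finsetSum _ fun i _ => integrable_unitaryHaar (by fun_prop),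
      integral_finsetSum _ fun i _ => integrable_unitaryHaar (by fun_prop), Finset.mul_sum]
    refine Finset.sum_congr rfl fun i _ => ?_
    rw [integral_finsetSum _ fun i _ => integrable_unitaryHaar (by fun_prop),
      integral_finsetSum _ fun i _ => integrable_unitaryHaar (by fun_prop), Finset.mul_sum]
    refine Finset.sum_congr rfl fun j _ => ?_
    simp only [mul_assoc ((c i - c j) ^ 2), integral_const_mul,
      integral_sub_mul_centeredForm_pow]
    ring
  have h_le : ∫ U, (∑ i, ∑ j, (c i - c j) ^ 2 * inner ℝ ((U.1 *ᵥ v) i) ((U.1 *ᵥ v) j) ^ 2) *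
      centeredForm c (U.1 *ᵥ v) ^ k ∂(unitaryHaar ι 𝕜) ≤
      ∫ U, Δ ^ 2 * centeredForm c (U.1 *ᵥ v) ^ k ∂(unitaryHaar ι 𝕜) :=
    integral_mono (integrable_unitaryHaar (by fun_prop)) (integrable_unitaryHaar (by fun_prop))
      fun U => mul_le_mul_of_nonneg_right (sum_sq_sub_mul_inner_sq_le hc (h_unit U))
        (hk.pow_nonneg _)
  rw [integral_const_mul] at h_parts h_le
  linarith [mul_le_mul_of_nonneg_left h_le (by positivity : (0 : ℝ) ≤ k + 1)]

theorem integral_centeredForm_pow_four_le {c : ι → ℝ} {Δ : ℝ} (hc : ∀ i j, |c i - c j| ≤ Δ)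
    {v : ι → 𝕜} (hv : ∑ i, ‖v i‖ ^ 2 = 1) :
    ∫ U, centeredForm c (U.1 *ᵥ v) ^ 4 ∂(unitaryHaar ι 𝕜) ≤ 3 * Δ ^ 4 / Fintype.card ι ^ 2 := by
  have h_two : Fintype.card ι * ∫ U, centeredForm c (U.1 *ᵥ v) ^ 2 ∂(unitaryHaar ι 𝕜) ≤ Δ ^ 2 := by
    simpa using card_mul_integral_centeredForm_pow_le hc hv Even.zero
  have h_four : Fintype.card ι * ∫ U, centeredForm c (U.1 *ᵥ v) ^ 4 ∂(unitaryHaar ι 𝕜) ≤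
      3 * Δ ^ 2 * ∫ U, centeredForm c (U.1 *ᵥ v) ^ 2 ∂(unitaryHaar ι 𝕜) := by
    convert card_mul_integral_centeredForm_pow_le hc hv even_two using 3
    norm_num
  have hcard : (0 : ℝ) < Fintype.card ι := by exact_mod_cast Fintype.card_pos
  rw [le_div_iff₀ (by positivity)]
  calc (∫ U, centeredForm c (U.1 *ᵥ v) ^ 4 ∂(unitaryHaar ι 𝕜)) * (Fintype.card ι : ℝ) ^ 2
      = Fintype.card ι * (Fintype.card ι * ∫ U, centeredForm c (U.1 *ᵥ v) ^ 4
          ∂(unitaryHaar ι 𝕜)) := by ring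
    _ ≤ Fintype.card ι * (3 * Δ ^ 2 * ∫ U, centeredForm c (U.1 *ᵥ v) ^ 2
          ∂(unitaryHaar ι 𝕜)) := mul_le_mul_of_nonneg_left h_four hcard.le
    _ = 3 * Δ ^ 2 * (Fintype.card ι * ∫ U, centeredForm c (U.1 *ᵥ v) ^ 2
          ∂(unitaryHaar ι 𝕜)) := by ring
    _ ≤ 3 * Δ ^ 2 * Δ ^ 2 := mul_le_mul_of_nonneg_left h_two (by positivity)
    _ = 3 * Δ ^ 4 := by ring

end Concentration

theorem exists_seq_polynomial_tendsto {f : ℝ → ℝ} (hf : Continuous f) :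
    ∃ p : ℕ → Polynomial ℝ, ∀ x, Tendsto (fun k => (p k).eval x) atTop (𝓝 (f x)) := by
  choose p hp using fun k : ℕ => exists_polynomial_near_of_continuousOn (-k) k f hf.continuousOn
    (1 / (k + 1)) (by positivity)
  refine ⟨p, fun x => tendsto_iff_dist_tendsto_zero.2 <| squeeze_zero' (.of_forall fun _ =>
    dist_nonneg) ?_ tendsto_one_div_add_atTop_nhds_zero_nat⟩
  filter_upwards [tendsto_natCast_atTop_atTop.eventually_ge_atTop |x|] with k hk
  exact (hp k x (abs_le.1 hk)).le

section FunctionalCalculus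

variable {𝕜 : Type*} [RCLike 𝕜] {ι : Type*} [Fintype ι] [DecidableEq ι]

theorem cfc_eq_conj_diagonal {A : Matrix ι ι 𝕜} (hA : A.IsHermitian) (f : ℝ → ℝ) :
    cfc f A = hA.eigenvectorUnitary.1 * diagonal (fun i => (f (hA.eigenvalues i) : 𝕜)) *
      star hA.eigenvectorUnitary.1 :=
  (hA.cfc_eq f).trans (Unitary.conjStarAlgAut_apply _ _)

theorem cfc_unitary_conj {f : ℝ → ℝ} (hf : Continuous f) (U : unitaryGroup ι 𝕜)
    (A : Matrix ι ι 𝕜) : cfc f (U.1 * A * star U.1) = U.1 * cfc f A * star U.1 := by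
  by_cases hA : IsSelfAdjoint A
  · have h_cont : Continuous (Unitary.conjStarAlgAut 𝕜 (Matrix ι ι 𝕜) U) :=
      (continuous_const.mul continuous_id).mul continuous_const
    simpa only [Unitary.conjStarAlgAut_apply] using (StarAlgHomClass.map_cfc
      (Unitary.conjStarAlgAut 𝕜 (Matrix ι ι 𝕜) U) f A hf.continuousOn h_cont hA
      (hA.map _)).symm
  · have hU : star U.1 * U.1 = 1 := mem_unitaryGroup_iff'.1 U.2
    have h_conj : ¬IsSelfAdjoint (U.1 * A * star U.1) := fun h => hA <| by
      simpa [Matrix.mul_assoc, hU, ← Matrix.mul_assoc (star U.1)] using h.conjugate' U.1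
    rw [cfc_apply_of_not_predicate _ hA, cfc_apply_of_not_predicate _ h_conj, mul_zero, zero_mul]

theorem tendsto_cfc {α : Type*} {l : Filter α} {F : α → ℝ → ℝ} {f : ℝ → ℝ}
    (hF : ∀ x, Tendsto (fun k => F k x) l (𝓝 (f x))) {A : Matrix ι ι 𝕜} (hA : A.IsHermitian) :
    Tendsto (fun k => cfc (F k) A) l (𝓝 (cfc f A)) := by
  simp only [cfc_eq_conj_diagonal hA]
  have h_diag : Tendsto (fun k i => (F k (hA.eigenvalues i) : 𝕜)) l
      (𝓝 fun i => (f (hA.eigenvalues i) : 𝕜)) :=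
    tendsto_pi_nhds.2 fun i => (RCLike.continuous_ofReal.tendsto _).comp (hF _)
  exact (((continuous_id.matrix_diagonal.tendsto _).comp h_diag).const_mul _).mul_const _

theorem measurable_cfc {f : ℝ → ℝ} (hf : Continuous f) :
    Measurable fun A : Matrix ι ι 𝕜 => cfc f A := by
  obtain ⟨p, hp⟩ := exists_seq_polynomial_tendsto hf
  let H : Set (Matrix ι ι 𝕜) := {A | IsSelfAdjoint A}
  have hH : MeasurableSet H := (isClosed_eq continuous_star continuous_id).measurableSet
  refine measurable_of_tendsto_metrizable
    (f := fun k => H.indicator fun A => Polynomial.aeval A (p k))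
    (fun k => (Polynomial.continuous_aeval (p k)).measurable.indicator hH)
    (tendsto_pi_nhds.2 fun A => ?_)
  by_cases hA : A ∈ H
  · simpa only [Set.indicator_of_mem hA, cfc_polynomial _ A hA.out] using tendsto_cfc hp hA
  · simpa only [Set.indicator_of_notMem hA,
      cfc_apply_of_not_predicate A (p := IsSelfAdjoint) hA] using tendsto_const_nhds

variable [Nonempty ι]

theorem integral_empiricalSpectralMeasure {A : Matrix ι ι 𝕜} (hA : A.IsHermitian) (f : ℝ → ℝ) :
    ∫ t, f t ∂(empiricalSpectralMeasure hA : Measure ℝ) =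
      (∑ i, f (hA.eigenvalues i)) / Fintype.card ι := by
  rw [empiricalSpectralMeasure, ProbabilityMeasure.coe_mk, integral_smul_measure,
    integral_finsetSum_measure fun i _ => integrable_dirac (by simp)]
  simp [div_eq_inv_mul]

end FunctionalCalculus

section TraceDefect

variable {𝕜 : Type*} [RCLike 𝕜] {ι : Type*}

/-- The matrix `v v*`, which is the orthogonal projection onto the line of `v` when `‖v‖ = 1`. -/
def lineProjection (v : EuclideanSpace 𝕜 ι) : Matrix ι ι 𝕜 :=
  vecMulVec v.ofLp (star v.ofLp)

variable [Fintype ι]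

theorem trace_lineProjection (v : EuclideanSpace 𝕜 ι) :
    (lineProjection v).trace = ((‖v‖ ^ 2 : ℝ) : 𝕜) := by
  simp [lineProjection, trace_vecMulVec, dotProduct, RCLike.mul_conj, EuclideanSpace.norm_sq_eq]

theorem measurable_re_trace : Measurable fun A : Matrix ι ι 𝕜 => RCLike.re A.trace :=
  Continuous.measurable (by fun_prop)

variable [DecidableEq ι]

/-- The integral `⟨v, f(A) v⟩` of `f` against the spectral measure of `A` at the vector `v`. -/
noncomputable def spectralAverage {A : Matrix ι ι 𝕜} (hA : A.IsHermitian)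
    (v : EuclideanSpace 𝕜 ι) (f : ℝ → ℝ) : ℝ :=
  ∑ i, f (hA.eigenvalues i) * ‖inner 𝕜 (hA.eigenvectorBasis i) v‖ ^ 2

/-- The difference between `tr (f(A) B)` and the value `tr B · tr f(A) / n` it would have on average
if the eigenvectors of `A` and `B` were in generic position; `f(A)` is taken to be `0` when `A` is
not Hermitian. -/
noncomputable def traceDefect (f : ℝ → ℝ) (A B : Matrix ι ι 𝕜) : ℝ :=
  RCLike.re (cfc f A * B).trace - RCLike.re B.trace * RCLike.re (cfc f A).trace / Fintype.card ι

theorem measurable_traceDefect {f : ℝ → ℝ} (hf : Continuous f) :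
    Measurable fun p : Matrix ι ι 𝕜 × Matrix ι ι 𝕜 => traceDefect f p.1 p.2 := by
  have h_cfc : Measurable fun p : Matrix ι ι 𝕜 × Matrix ι ι 𝕜 => cfc f p.1 :=
    (measurable_cfc hf).comp measurable_fst
  have h_mul : Measurable fun p : Matrix ι ι 𝕜 × Matrix ι ι 𝕜 => cfc f p.1 * p.2 :=
    Measurable.comp (g := fun q : Matrix ι ι 𝕜 × Matrix ι ι 𝕜 => q.1 * q.2)
      (Continuous.measurable (by fun_prop)) (h_cfc.prodMk measurable_snd)
  exact (measurable_re_trace.comp h_mul).sub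
    (((measurable_re_trace.comp measurable_snd).mul (measurable_re_trace.comp h_cfc)).div_const _)

theorem trace_unitary_conj (U : unitaryGroup ι 𝕜) (A : Matrix ι ι 𝕜) :
    (U.1 * A * star U.1).trace = A.trace := by
  rw [trace_mul_cycle, mem_unitaryGroup_iff'.1 U.2, one_mul]

theorem traceDefect_unitary_conj {f : ℝ → ℝ} (hf : Continuous f) (U : unitaryGroup ι 𝕜)
    (A B : Matrix ι ι 𝕜) :
    traceDefect f (U.1 * A * star U.1) (U.1 * B * star U.1) = traceDefect f A B := by
  have h_mul : U.1 * cfc f A * star U.1 * (U.1 * B * star U.1) =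
      U.1 * (cfc f A * B) * star U.1 := by
    simp only [Matrix.mul_assoc, ← Matrix.mul_assoc (star U.1) U.1,
      mem_unitaryGroup_iff'.1 U.2, Matrix.one_mul]
  rw [traceDefect, cfc_unitary_conj hf, h_mul, trace_unitary_conj, trace_unitary_conj,
    trace_unitary_conj, traceDefect]

theorem unitary_conj_lineProjection (U : unitaryGroup ι 𝕜) (v : EuclideanSpace 𝕜 ι) :
    U.1 * lineProjection v * star U.1 = lineProjection (WithLp.toLp 2 (U.1 *ᵥ v.ofLp)) := by
  rw [lineProjection, lineProjection, mul_vecMulVec, vecMulVec_mul, star_mulVec,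
    star_eq_conjTranspose]

theorem inner_eigenvectorBasis {A : Matrix ι ι 𝕜} (hA : A.IsHermitian) (v : EuclideanSpace 𝕜 ι)
    (i : ι) : inner 𝕜 (hA.eigenvectorBasis i) v = (star hA.eigenvectorUnitary.1 *ᵥ v.ofLp) i := by
  simp [EuclideanSpace.inner_eq_star_dotProduct, mulVec, dotProduct, mul_comm]

theorem trace_cfc {A : Matrix ι ι 𝕜} (hA : A.IsHermitian) (f : ℝ → ℝ) :
    (cfc f A).trace = ((∑ i, f (hA.eigenvalues i) : ℝ) : 𝕜) := by
  rw [cfc_eq_conj_diagonal hA, trace_unitary_conj, trace_diagonal]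
  push_cast
  rfl

theorem trace_cfc_mul_lineProjection {A : Matrix ι ι 𝕜} (hA : A.IsHermitian)
    (v : EuclideanSpace 𝕜 ι) (f : ℝ → ℝ) :
    (cfc f A * lineProjection v).trace = (spectralAverage hA v f : 𝕜) := by
  rw [cfc_eq_conj_diagonal hA, lineProjection, mul_vecMulVec, trace_vecMulVec, ← mulVec_mulVec,
    ← mulVec_mulVec, dotProduct_comm, dotProduct_mulVec]
  have h_star : star v.ofLp ᵥ* hA.eigenvectorUnitary.1 =
      star (star hA.eigenvectorUnitary.1 *ᵥ v.ofLp) := by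
    rw [star_mulVec, star_eq_conjTranspose, conjTranspose_conjTranspose]
  rw [h_star]
  simp only [spectralAverage, inner_eigenvectorBasis, dotProduct, mulVec_diagonal]
  push_cast
  refine Finset.sum_congr rfl fun i _ => ?_
  rw [← RCLike.conj_mul]
  simp only [Pi.star_apply, RCLike.star_def]
  ring

variable [Nonempty ι]

theorem traceDefect_lineProjection {A : Matrix ι ι 𝕜} (hA : A.IsHermitian) (f : ℝ → ℝ) (θ : ℝ)
    {v : EuclideanSpace 𝕜 ι} (hv : ‖v‖ = 1) :
    traceDefect f A ((θ : 𝕜) • lineProjection v) =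
      θ * (spectralAverage hA v f - ∫ t, f t ∂(empiricalSpectralMeasure hA : Measure ℝ)) := by
  rw [traceDefect, mul_smul_comm, trace_smul, trace_smul, trace_lineProjection,
    trace_cfc_mul_lineProjection hA, trace_cfc hA, integral_empiricalSpectralMeasure, hv]
  simp only [smul_eq_mul, RCLike.mul_re, RCLike.ofReal_re, RCLike.ofReal_im, mul_zero, sub_zero,
    one_pow, map_one, mul_one, map_sum]
  ring

theorem spectralAverage_sub_integral_eq_centeredForm {A : Matrix ι ι 𝕜} (hA : A.IsHermitian)
    (f : ℝ → ℝ) (v : EuclideanSpace 𝕜 ι) :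
    spectralAverage hA v f - ∫ t, f t ∂(empiricalSpectralMeasure hA : Measure ℝ) =
      centeredForm (f ∘ hA.eigenvalues) (star hA.eigenvectorUnitary.1 *ᵥ v.ofLp) := by
  simp only [spectralAverage, integral_empiricalSpectralMeasure, centeredForm,
    inner_eigenvectorBasis, Function.comp_apply]

theorem integral_traceDefect_pow_four_le {A : Matrix ι ι 𝕜} (hA : A.IsHermitian) {f : ℝ → ℝ}
    {Δ : ℝ} (hf : ∀ s t, |f s - f t| ≤ Δ) (θ : ℝ) {v : EuclideanSpace 𝕜 ι} (hv : ‖v‖ = 1) :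
    ∫ U, traceDefect f A (U.1 * ((θ : 𝕜) • lineProjection v) * star U.1) ^ 4 ∂(unitaryHaar ι 𝕜) ≤
      3 * (θ * Δ) ^ 4 / Fintype.card ι ^ 2 := by
  have hv_sum : ∑ i, ‖v.ofLp i‖ ^ 2 = 1 := by rw [← EuclideanSpace.norm_sq_eq, hv, one_pow]
  let c := f ∘ hA.eigenvalues
  have h_eq (U : unitaryGroup ι 𝕜) :
      traceDefect f A (U.1 * ((θ : 𝕜) • lineProjection v) * star U.1) ^ 4 =
        θ ^ 4 * centeredForm c ((star hA.eigenvectorUnitary).1 *ᵥ (U.1 *ᵥ v.ofLp)) ^ 4 := by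
    have h_norm : ‖WithLp.toLp 2 (U.1 *ᵥ v.ofLp)‖ = 1 := by
      rw [← sq_eq_sq₀ (norm_nonneg _) zero_le_one, EuclideanSpace.norm_sq_eq, one_pow]
      exact (sum_norm_sq_mulVec U v.ofLp).trans hv_sum
    rw [mul_smul_comm, smul_mul_assoc, unitary_conj_lineProjection,
      traceDefect_lineProjection hA f θ h_norm, spectralAverage_sub_integral_eq_centeredForm,
      mul_pow]
    rfl
  simp only [h_eq]
  rw [integral_const_mul, integral_unitaryHaar_mulVec (fun x => centeredForm c x ^ 4),
    mul_pow, mul_left_comm, mul_div_assoc]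
  exact mul_le_mul_of_nonneg_left (integral_centeredForm_pow_four_le (fun i j => hf _ _) hv_sum)
    (by positivity)

end TraceDefect

section RandomConjugation

variable {𝕜 : Type*} [RCLike 𝕜] {Ω : Type*} [MeasurableSpace Ω] {Pr : Measure Ω}

theorem ae_tendsto_zero_of_tsum_lintegral_ne_top {g : ℕ → Ω → ENNReal}
    (hg : ∀ n, AEMeasurable (g n) Pr) (h_sum : ∑' n, ∫⁻ ω, g n ω ∂Pr ≠ ⊤) :
    ∀ᵐ ω ∂Pr, Tendsto (fun n => g n ω) atTop (𝓝 0) := by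
  rw [← lintegral_tsum hg] at h_sum
  filter_upwards [ae_lt_top' (AEMeasurable.tsum hg) h_sum] with ω hω
  exact ENNReal.tendsto_atTop_zero_of_tsum_ne_top hω.ne

theorem ae_tendsto_zero_of_lintegral_pow_four_le {f : ℕ → Ω → ℝ} (hf : ∀ n, Measurable (f n))
    {b : ℕ → ℝ} (hb : Summable b)
    (h : ∀ n, ∫⁻ ω, ENNReal.ofReal (f n ω ^ 4) ∂Pr ≤ ENNReal.ofReal (b n)) :
    ∀ᵐ ω ∂Pr, Tendsto (fun n => f n ω) atTop (𝓝 0) := by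
  have h_sum : ∑' n, ∫⁻ ω, ENNReal.ofReal (f n ω ^ 4) ∂Pr ≠ ⊤ :=
    ne_top_of_le_ne_top hb.tsum_ofReal_ne_top (ENNReal.tsum_le_tsum h)
  filter_upwards [ae_tendsto_zero_of_tsum_lintegral_ne_top
    (fun n => ((hf n).pow_const 4).ennreal_ofReal.aemeasurable) h_sum] with ω hω
  have h_pow : Tendsto (fun n => f n ω ^ 4) atTop (𝓝 0) :=
    ((ENNReal.tendsto_toReal ENNReal.zero_ne_top).comp hω).congr fun n =>
      ENNReal.toReal_ofReal (by positivity)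
  refine (tendsto_zero_iff_abs_tendsto_zero _).2 ?_
  have h_sqrt := h_pow.sqrt.sqrt
  simp only [Real.sqrt_zero] at h_sqrt
  refine h_sqrt.congr fun n => ?_
  rw [show f n ω ^ 4 = (f n ω ^ 2) ^ 2 by ring, Real.sqrt_sq (sq_nonneg _),
    Real.sqrt_sq_eq_abs, Function.comp_apply]

variable [IsProbabilityMeasure Pr]

theorem lintegral_conj_eq {ι : Type*} [Fintype ι] [DecidableEq ι]
    {X P : Ω → Matrix ι ι 𝕜} (hX : Measurable X) (hP : Measurable P) (hind : IndepFun X P Pr)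
    (hinv : IsConjInvariant Pr X ∨ IsConjInvariant Pr P)
    {g : Matrix ι ι 𝕜 × Matrix ι ι 𝕜 → ENNReal} (hg : Measurable g)
    (h_conj : ∀ (U : unitaryGroup ι 𝕜) A B,
      g (U.1 * A * star U.1, U.1 * B * star U.1) = g (A, B))
    (U : unitaryGroup ι 𝕜) :
    ∫⁻ ω, g (X ω, U.1 * P ω * star U.1) ∂Pr = ∫⁻ ω, g (X ω, P ω) ∂Pr := by
  have eq_of_map_eq {X' P' : Ω → Matrix ι ι 𝕜} (hX' : Measurable X') (hP' : Measurable P')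
      (hind' : IndepFun X' P' Pr) (h_map_X : Pr.map X' = Pr.map X)
      (h_map_P : Pr.map P' = Pr.map P) :
      ∫⁻ ω, g (X' ω, P' ω) ∂Pr = ∫⁻ ω, g (X ω, P ω) ∂Pr := by
    rw [← lintegral_map hg (hX'.prodMk hP'), ← lintegral_map hg (hX.prodMk hP),
      (indepFun_iff_map_prod_eq_prod_map_map hX'.aemeasurable hP'.aemeasurable).1 hind',
      (indepFun_iff_map_prod_eq_prod_map_map hX.aemeasurable hP.aemeasurable).1 hind,
      h_map_X, h_map_P]
  have h_meas (V : unitaryGroup ι 𝕜) : Measurable fun A : Matrix ι ι 𝕜 => V.1 * A * star V.1 :=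
    Continuous.measurable (by fun_prop)
  rcases hinv with hX_inv | hP_inv
  · have h_undo (B : Matrix ι ι 𝕜) :
        (star U).1 * (U.1 * B * star U.1) * star (star U).1 = B := by
      have hU : star U.1 * U.1 = 1 := mem_unitaryGroup_iff'.1 U.2
      calc (star U).1 * (U.1 * B * star U.1) * star (star U).1
          = (star U.1 * U.1) * B * (star U.1 * U.1) := by
            simp only [Matrix.mul_assoc, Unitary.coe_star, star_star]
        _ = B := by rw [hU, Matrix.one_mul, Matrix.mul_one]
    rw [← eq_of_map_eq ((h_meas (star U)).comp hX) hP
      (hind.comp (h_meas (star U)) measurable_id) (hX_inv _ (star U).2) rfl]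
    refine lintegral_congr fun ω => ?_
    rw [← h_conj (star U), h_undo, Function.comp_apply]
  · exact eq_of_map_eq hX ((h_meas U).comp hP) (hind.comp measurable_id (h_meas U)) rfl
      (hP_inv _ U.2)

theorem lintegral_eq_lintegral_unitaryHaar_conj {ι : Type*} [Fintype ι] [DecidableEq ι]
    {X P : Ω → Matrix ι ι 𝕜} (hX : Measurable X) (hP : Measurable P) (hind : IndepFun X P Pr)
    (hinv : IsConjInvariant Pr X ∨ IsConjInvariant Pr P)
    {g : Matrix ι ι 𝕜 × Matrix ι ι 𝕜 → ENNReal} (hg : Measurable g)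
    (h_conj : ∀ (U : unitaryGroup ι 𝕜) A B,
      g (U.1 * A * star U.1, U.1 * B * star U.1) = g (A, B)) :
    ∫⁻ ω, g (X ω, P ω) ∂Pr =
      ∫⁻ ω, ∫⁻ U, g (X ω, U.1 * P ω * star U.1) ∂(unitaryHaar ι 𝕜) ∂Pr := by
  let pair (q : unitaryGroup ι 𝕜 × Ω) := (X q.2, q.1.1 * P q.2 * star q.1.1)
  have h_pair : Measurable pair := by
    have h_mul : Measurable fun r : unitaryGroup ι 𝕜 × Matrix ι ι 𝕜 => r.1.1 * r.2 * star r.1.1 :=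
      Continuous.measurable (by fun_prop)
    have h_arg : Measurable fun q : unitaryGroup ι 𝕜 × Ω => (q.1, P q.2) :=
      measurable_fst.prodMk (hP.comp measurable_snd)
    exact (hX.comp measurable_snd).prodMk
      (Measurable.comp (f := fun q : unitaryGroup ι 𝕜 × Ω => (q.1, P q.2)) h_mul h_arg)
  rw [← lintegral_lintegral_swap (f := fun U ω => g (pair (U, ω))) (hg.comp h_pair).aemeasurable]
  simp only [pair, lintegral_conj_eq hX hP hind hinv hg h_conj, lintegral_const, measure_univ,
    mul_one]

theorem lintegral_traceDefect_pow_four_le {ι : Type*} [Fintype ι] [DecidableEq ι] [Nonempty ι]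
    {X P : Ω → Matrix ι ι 𝕜} (hX_meas : Measurable X) (hP_meas : Measurable P)
    (hX : ∀ ω, (X ω).IsHermitian) {θ : ℝ} {v : Ω → EuclideanSpace 𝕜 ι} (hv : ∀ ω, ‖v ω‖ = 1)
    (hP : ∀ ω, P ω = (θ : 𝕜) • lineProjection (v ω)) (hind : IndepFun X P Pr)
    (hinv : IsConjInvariant Pr X ∨ IsConjInvariant Pr P)
    {f : ℝ → ℝ} (hf : Continuous f) {Δ : ℝ} (hfΔ : ∀ s t, |f s - f t| ≤ Δ) :
    ∫⁻ ω, ENNReal.ofReal (traceDefect f (X ω) (P ω) ^ 4) ∂Pr ≤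
      ENNReal.ofReal (3 * (θ * Δ) ^ 4 / Fintype.card ι ^ 2) := by
  rw [lintegral_eq_lintegral_unitaryHaar_conj hX_meas hP_meas hind hinv
    (g := fun p => ENNReal.ofReal (traceDefect f p.1 p.2 ^ 4))
    ((measurable_traceDefect hf).pow_const 4).ennreal_ofReal
    fun U A B => by simp only [traceDefect_unitary_conj hf]]
  suffices h : ∀ ω, ∫⁻ U, ENNReal.ofReal (traceDefect f (X ω) (U.1 * P ω * star U.1) ^ 4)
      ∂(unitaryHaar ι 𝕜) ≤ ENNReal.ofReal (3 * (θ * Δ) ^ 4 / Fintype.card ι ^ 2) by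
    simpa using lintegral_mono (μ := Pr) h
  intro ω
  have h_cont : Continuous fun U : unitaryGroup ι 𝕜 =>
      traceDefect f (X ω) (U.1 * P ω * star U.1) ^ 4 := by
    unfold traceDefect
    fun_prop
  rw [← ofReal_integral_eq_lintegral_ofReal (integrable_unitaryHaar h_cont)
    (.of_forall fun U => by positivity), hP]
  exact ENNReal.ofReal_le_ofReal (integral_traceDefect_pow_four_le (hX ω) hfΔ θ (hv ω))

theorem ae_tendsto_spectralAverage
    {X P : ∀ n : ℕ, Ω → Matrix (Fin (n + 1)) (Fin (n + 1)) 𝕜}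
    (hX_meas : ∀ n, Measurable (X n)) (hP_meas : ∀ n, Measurable (P n))
    (hX : ∀ n ω, (X n ω).IsHermitian) {θ : ℝ} (hθ : θ ≠ 0)
    {v : ∀ n, Ω → EuclideanSpace 𝕜 (Fin (n + 1))} (hv : ∀ n ω, ‖v n ω‖ = 1)
    (hP : ∀ n ω, P n ω = (θ : 𝕜) • lineProjection (v n ω))
    (hind : ∀ n, IndepFun (X n) (P n) Pr)
    (hinv : ∀ n, IsConjInvariant Pr (X n) ∨ IsConjInvariant Pr (P n))
    {μ : ProbabilityMeasure ℝ}
    (hesd : ∀ᵐ ω ∂Pr, Tendsto (fun n => empiricalSpectralMeasure (hX n ω)) atTop (𝓝 μ))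
    (f : BoundedContinuousFunction ℝ ℝ) :
    ∀ᵐ ω ∂Pr, Tendsto (fun n => spectralAverage (hX n ω) (v n ω) f) atTop (𝓝 (∫ t, f t ∂μ)) := by
  have h_summable : Summable fun n : ℕ =>
      3 * (θ * (2 * ‖f‖)) ^ 4 / (Fintype.card (Fin (n + 1)) : ℝ) ^ 2 := by
    simp only [Fintype.card_fin, div_eq_mul_one_div (3 * (θ * (2 * ‖f‖)) ^ 4)]
    exact ((summable_nat_add_iff 1).2 (Real.summable_one_div_nat_pow.2 one_lt_two)).mul_left _
  have h_meas (n : ℕ) : Measurable fun ω => traceDefect f (X n ω) (P n ω) :=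
    Measurable.comp (f := fun ω => (X n ω, P n ω)) (measurable_traceDefect f.continuous)
      ((hX_meas n).prodMk (hP_meas n))
  filter_upwards [hesd, ae_tendsto_zero_of_lintegral_pow_four_le h_meas h_summable fun n =>
    lintegral_traceDefect_pow_four_le (hX_meas n) (hP_meas n) (hX n) (hv n) (hP n) (hind n)
      (hinv n) f.continuous f.dist_le_two_norm] with ω h_esd h_defect
  have h_integral := ProbabilityMeasure.tendsto_iff_forall_integral_tendsto.1 h_esd f
  simp only [hP, traceDefect_lineProjection (hX _ _) _ θ (hv _ _)] at h_defect
  simpa [hθ] using (h_defect.const_mul θ⁻¹).add h_integral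

end RandomConjugation

section RankOne

variable {𝕜 : Type*} [RCLike 𝕜] {ι : Type*} [Fintype ι] [DecidableEq ι]

theorem toEuclideanLin_lineProjection (v x : EuclideanSpace 𝕜 ι) :
    toEuclideanLin (lineProjection v) x = inner 𝕜 v x • v := by
  ext i
  simp [toLpLin_apply, lineProjection, vecMulVec_mulVec, EuclideanSpace.inner_eq_star_dotProduct,
    dotProduct_comm, mul_comm]

theorem exists_eq_smul_lineProjection {A : Matrix ι ι 𝕜} (hA : A.IsHermitian) (hrank : A.rank = 1)
    {θ : ℝ} (hθ : θ ≠ 0) (heig : Module.End.HasEigenvalue (toLin' A) (θ : 𝕜)) :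
    ∃ v : EuclideanSpace 𝕜 ι, ‖v‖ = 1 ∧ A = (θ : 𝕜) • lineProjection v := by
  obtain ⟨w, hw⟩ := heig.exists_hasEigenvector
  obtain ⟨v, hv, hAv⟩ : ∃ v : EuclideanSpace 𝕜 ι, ‖v‖ = 1 ∧ toEuclideanLin A v = (θ : 𝕜) • v := by
    let x : EuclideanSpace 𝕜 ι := WithLp.toLp 2 w
    have hx : x ≠ 0 := by simpa [x] using hw.2
    have hAx : toEuclideanLin A x = (θ : 𝕜) • x := congrArg (WithLp.toLp 2) hw.apply_eq_smul
    exact ⟨(‖x‖ : 𝕜)⁻¹ • x, norm_smul_inv_norm hx, by rw [map_smul, hAx, smul_comm]⟩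
  have hv0 : v ≠ 0 := norm_ne_zero_iff.1 (hv ▸ one_ne_zero)
  have h_range (x : EuclideanSpace 𝕜 ι) : ∃ c : 𝕜, toEuclideanLin A x = c • v := by
    have h_finrank : Module.finrank 𝕜 (LinearMap.range (toEuclideanLin A)) = 1 := by
      rw [toEuclideanLin_eq_toLin_orthonormal, ← rank_eq_finrank_range_toLin, hrank]
    have h_mem : v ∈ LinearMap.range (toEuclideanLin A) :=
      ⟨(θ : 𝕜)⁻¹ • v, by rw [map_smul, hAv, inv_smul_smul₀ (by simpa using hθ)]⟩
    obtain ⟨c, hc⟩ := (finrank_eq_one_iff_of_nonzero' ⟨v, h_mem⟩ (by simpa using hv0)).1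
      h_finrank ⟨_, LinearMap.mem_range_self _ x⟩
    exact ⟨c, (congrArg Subtype.val hc).symm⟩
  refine ⟨v, hv, toEuclideanLin.injective (LinearMap.ext fun x => ?_)⟩
  obtain ⟨c, hc⟩ := h_range x
  have hc_eq : c = (θ : 𝕜) * inner 𝕜 v x :=
    calc c = inner 𝕜 v (toEuclideanLin A x) := by
          simp [hc, inner_smul_right, inner_self_eq_norm_sq_to_K, hv]
      _ = inner 𝕜 (toEuclideanLin A v) x := (isSymmetric_toEuclideanLin_iff.2 hA v x).symm
      _ = (θ : 𝕜) * inner 𝕜 v x := by rw [hAv, inner_smul_left, RCLike.conj_ofReal]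
  rw [hc, hc_eq, map_smul, LinearMap.smul_apply, toEuclideanLin_lineProjection, smul_smul]

theorem kerSub_smul_lineProjection {θ : ℝ} (hθ : θ ≠ 0) {v : EuclideanSpace 𝕜 ι} (hv : ‖v‖ = 1) :
    kerSub θ ((θ : 𝕜) • lineProjection v) = 𝕜 ∙ v := by
  have hθ' : (θ : 𝕜) ≠ 0 := by simpa using hθ
  have h_apply (x : EuclideanSpace 𝕜 ι) :
      toEuclideanLin ((θ : 𝕜) • (1 : Matrix ι ι 𝕜) - (θ : 𝕜) • lineProjection v) x =
        (θ : 𝕜) • (x - inner 𝕜 v x • v) := by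
    rw [map_sub, map_smul, map_smul, LinearMap.sub_apply, LinearMap.smul_apply,
      LinearMap.smul_apply, toEuclideanLin_lineProjection, smul_sub]
    simp
  ext x
  rw [kerSub, LinearMap.mem_ker, h_apply, smul_eq_zero, or_iff_right hθ', sub_eq_zero,
    Submodule.mem_span_singleton]
  refine ⟨fun hx => ⟨_, hx.symm⟩, ?_⟩
  rintro ⟨c, rfl⟩
  simp [inner_smul_right, inner_self_eq_norm_sq_to_K, hv]

theorem projNorm_kerSub_smul_lineProjection {θ : ℝ} (hθ : θ ≠ 0) {v : EuclideanSpace 𝕜 ι}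
    (hv : ‖v‖ = 1) (u : EuclideanSpace 𝕜 ι) :
    projNorm u (kerSub θ ((θ : 𝕜) • lineProjection v)) = ‖(inner 𝕜 v u : 𝕜)‖ := by
  rw [kerSub_smul_lineProjection hθ hv, projNorm, ← Submodule.norm_coe,
    Submodule.coe_orthogonalProjectionOnto_apply, Submodule.starProjection_unit_singleton 𝕜 hv,
    norm_smul, hv, mul_one]

end RankOne

section PerturbedEigenvector

variable {𝕜 : Type*} [RCLike 𝕜]

section

variable {ι : Type*} [Fintype ι]

theorem inner_mul_inner_symm (x y : EuclideanSpace 𝕜 ι) :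
    (inner 𝕜 x y * inner 𝕜 y x : 𝕜) = ((‖(inner 𝕜 y x : 𝕜)‖ ^ 2 : ℝ) : 𝕜) := by
  rw [← inner_conj_symm, RCLike.conj_mul, RCLike.ofReal_pow]

variable [DecidableEq ι] {A : Matrix ι ι 𝕜}

theorem inner_eigenvectorBasis_toEuclideanLin (hA : A.IsHermitian) (x : EuclideanSpace 𝕜 ι)
    (i : ι) : inner 𝕜 (hA.eigenvectorBasis i) (toEuclideanLin A x) =
      (hA.eigenvalues i : 𝕜) * inner 𝕜 (hA.eigenvectorBasis i) x := by
  have h_eig : toEuclideanLin A (hA.eigenvectorBasis i) =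
      (hA.eigenvalues i : 𝕜) • hA.eigenvectorBasis i := by
    ext j
    simpa [RCLike.real_smul_eq_coe_mul, toLpLin_apply] using
      congrFun (hA.mulVec_eigenvectorBasis i) j
  rw [← isSymmetric_toEuclideanLin_iff.2 hA, h_eig, inner_smul_left, RCLike.conj_ofReal]

theorem re_inner_toEuclideanLin_self (hA : A.IsHermitian) (x : EuclideanSpace 𝕜 ι) :
    RCLike.re (inner 𝕜 x (toEuclideanLin A x)) = spectralAverage hA x id := by
  rw [← hA.eigenvectorBasis.sum_inner_mul_inner, map_sum, spectralAverage]
  refine Finset.sum_congr rfl fun i _ => ?_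
  rw [inner_eigenvectorBasis_toEuclideanLin, mul_left_comm, inner_mul_inner_symm,
    ← RCLike.ofReal_mul, RCLike.ofReal_re, id]

theorem spectralAverage_le_spectralAverage (hA : A.IsHermitian) (v : EuclideanSpace 𝕜 ι)
    {f g : ℝ → ℝ} (hfg : ∀ i, f (hA.eigenvalues i) ≤ g (hA.eigenvalues i)) :
    spectralAverage hA v f ≤ spectralAverage hA v g :=
  Finset.sum_le_sum fun i _ => mul_le_mul_of_nonneg_right (hfg i) (sq_nonneg _)

theorem spectralAverage_const (hA : A.IsHermitian) (v : EuclideanSpace 𝕜 ι) (C : ℝ) :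
    spectralAverage hA v (fun _ => C) = C * ‖v‖ ^ 2 := by
  rw [spectralAverage, ← Finset.mul_sum, hA.eigenvectorBasis.sum_sq_norm_inner_right]

theorem eigenvalues_le_largestEigenvalue_add [Nonempty ι] (hA : A.IsHermitian) {θ : ℝ} (hθ : 0 ≤ θ)
    {v : EuclideanSpace 𝕜 ι} (hA' : (A + (θ : 𝕜) • lineProjection v).IsHermitian) (i : ι) :
    hA.eigenvalues i ≤ largestEigenvalue hA' := by
  let e := hA.eigenvectorBasis i
  have he : ‖e‖ = 1 := hA.eigenvectorBasis.norm_eq_one i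
  calc hA.eigenvalues i
      ≤ hA.eigenvalues i + θ * ‖(inner 𝕜 e v : 𝕜)‖ ^ 2 := le_add_of_nonneg_right (by positivity)
    _ = RCLike.re (inner 𝕜 e (toEuclideanLin (A + (θ : 𝕜) • lineProjection v) e)) := by
        simp only [map_add, map_smul, LinearMap.add_apply, LinearMap.smul_apply, inner_add_right,
          inner_smul_right, toEuclideanLin_lineProjection, inner_mul_inner_symm]
        rw [inner_eigenvectorBasis_toEuclideanLin, inner_self_eq_norm_sq_to_K, he]
        simp
    _ ≤ spectralAverage hA' e fun _ => largestEigenvalue hA' := by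
        rw [re_inner_toEuclideanLin_self hA']
        exact spectralAverage_le_spectralAverage hA' e fun j => Finset.le_sup' _ (Finset.mem_univ j)
    _ = largestEigenvalue hA' := by rw [spectralAverage_const, he, one_pow, mul_one]

section

variable {θ L : ℝ} {v u : EuclideanSpace 𝕜 ι}

theorem mul_inner_mul_inner_eigenvectorBasis (hA : A.IsHermitian)
    (hu : toEuclideanLin (A + (θ : 𝕜) • lineProjection v) u = (L : 𝕜) • u) (i : ι) :
    (θ : 𝕜) * inner 𝕜 v u * inner 𝕜 (hA.eigenvectorBasis i) v =
      ((L - hA.eigenvalues i : ℝ) : 𝕜) * inner 𝕜 (hA.eigenvectorBasis i) u := by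
  have h := congrArg (fun x => (inner 𝕜 (hA.eigenvectorBasis i) x : 𝕜)) hu
  simp only [map_add, map_smul, LinearMap.add_apply, LinearMap.smul_apply, inner_add_right,
    inner_smul_right, inner_eigenvectorBasis_toEuclideanLin, toEuclideanLin_lineProjection] at h
  push_cast
  linear_combination h

theorem secular_equation (hA : A.IsHermitian)
    (hu : toEuclideanLin (A + (θ : 𝕜) • lineProjection v) u = (L : 𝕜) • u) (hu0 : u ≠ 0)
    (hL : ∀ i, hA.eigenvalues i ≠ L) : θ * spectralAverage hA v (fun t => 1 / (L - t)) = 1 := by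
  have h_coord (i : ι) : (inner 𝕜 (hA.eigenvectorBasis i) u : 𝕜) =
      (θ : 𝕜) * inner 𝕜 v u * inner 𝕜 (hA.eigenvectorBasis i) v *
        ((1 / (L - hA.eigenvalues i) : ℝ) : 𝕜) := by
    have hL' : ((L - hA.eigenvalues i : ℝ) : 𝕜) ≠ 0 := by simpa [sub_eq_zero] using (hL i).symm
    rw [mul_inner_mul_inner_eigenvectorBasis hA hu]
    push_cast at hL' ⊢
    field_simp
  have h_overlap : (inner 𝕜 v u : 𝕜) ≠ 0 := fun h0 => hu0 <| by
    simpa [h_coord, h0] using (hA.eigenvectorBasis.sum_sq_norm_inner_right u).symm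
  have h_inner : (inner 𝕜 v u : 𝕜) =
      inner 𝕜 v u * ((θ * spectralAverage hA v fun t => 1 / (L - t) : ℝ) : 𝕜) := by
    conv_lhs => rw [← hA.eigenvectorBasis.sum_inner_mul_inner]
    simp only [h_coord, spectralAverage]
    rw [Finset.mul_sum, RCLike.ofReal_sum, Finset.mul_sum]
    refine Finset.sum_congr rfl fun i _ => ?_
    rw [RCLike.ofReal_mul, RCLike.ofReal_mul, ← inner_mul_inner_symm]
    ring
  exact_mod_cast (mul_eq_left₀ h_overlap).1 h_inner.symm

theorem one_le_mul_spectralAverage (hA : A.IsHermitian)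
    (hu : toEuclideanLin (A + (θ : 𝕜) • lineProjection v) u = (L : 𝕜) • u) (hu0 : u ≠ 0)
    (hθ : 0 ≤ θ) {z : ℝ} (hz : ∀ i, hA.eigenvalues i < z) (hzL : z ≤ L) :
    1 ≤ θ * spectralAverage hA v fun t => 1 / (z - t) := by
  refine (secular_equation hA hu hu0 fun i => ((hz i).trans_le hzL).ne).symm.trans_le ?_
  refine mul_le_mul_of_nonneg_left (spectralAverage_le_spectralAverage hA v fun i => ?_) hθ
  exact one_div_le_one_div_of_le (sub_pos.2 (hz i)) (sub_le_sub_right hzL _)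

theorem mul_norm_inner_sq_mul_spectralAverage_le (hA : A.IsHermitian)
    (hu : toEuclideanLin (A + (θ : 𝕜) • lineProjection v) u = (L : 𝕜) • u)
    (hL : ∀ i, hA.eigenvalues i ≤ L) {z : ℝ} (hLz : L < z) :
    (θ * ‖(inner 𝕜 v u : 𝕜)‖) ^ 2 * spectralAverage hA v (fun t => 1 / (z - t) ^ 2) ≤ ‖u‖ ^ 2 := by
  rw [← hA.eigenvectorBasis.sum_sq_norm_inner_right, spectralAverage, Finset.mul_sum]
  refine Finset.sum_le_sum fun i _ => ?_
  have h_norm := congrArg (‖·‖ ^ 2) (mul_inner_mul_inner_eigenvectorBasis hA hu i)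
  simp only [norm_mul, RCLike.norm_ofReal, mul_pow, sq_abs] at h_norm
  have hLi := hL i
  have hzi : 0 < z - hA.eigenvalues i := by linarith
  calc (θ * ‖(inner 𝕜 v u : 𝕜)‖) ^ 2 * (1 / (z - hA.eigenvalues i) ^ 2 *
        ‖(inner 𝕜 (hA.eigenvectorBasis i) v : 𝕜)‖ ^ 2)
      = ((L - hA.eigenvalues i) / (z - hA.eigenvalues i)) ^ 2 *
          ‖(inner 𝕜 (hA.eigenvectorBasis i) u : 𝕜)‖ ^ 2 := by
        field_simp
        linear_combination h_norm
    _ ≤ ‖(inner 𝕜 (hA.eigenvectorBasis i) u : 𝕜)‖ ^ 2 := by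
        refine mul_le_of_le_one_left (sq_nonneg _) (pow_le_one₀ ?_ ?_)
        · exact div_nonneg (sub_nonneg.2 hLi) hzi.le
        · exact (div_le_one hzi).2 (by linarith)

end

end

theorem tendsto_norm_inner_zero {ι : ℕ → Type*} [∀ n, Fintype (ι n)] [∀ n, DecidableEq (ι n)]
    {A : ∀ n, Matrix (ι n) (ι n) 𝕜} (hA : ∀ n, (A n).IsHermitian) {θ : ℝ} (hθ : 0 < θ)
    {v u : ∀ n, EuclideanSpace 𝕜 (ι n)} (hu_norm : ∀ n, ‖u n‖ = 1) {L : ℕ → ℝ}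
    (hu : ∀ n, toEuclideanLin (A n + (θ : 𝕜) • lineProjection (v n)) (u n) = (L n : 𝕜) • u n)
    (hL : ∀ n i, (hA n).eigenvalues i ≤ L n) {z g₁ g₂ : ℕ → ℝ}
    (hz : ∀ j, ∀ᶠ n in atTop, ∀ i, (hA n).eigenvalues i < z j)
    (hg₁ : ∀ j, Tendsto (fun n => spectralAverage (hA n) (v n) fun t => 1 / (z j - t)) atTop
      (𝓝 (g₁ j)))
    (hg₂ : ∀ j, Tendsto (fun n => spectralAverage (hA n) (v n) fun t => 1 / (z j - t) ^ 2) atTop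
      (𝓝 (g₂ j)))
    (h_lt : ∀ j, θ * g₁ j < 1) (h_top : Tendsto g₂ atTop atTop) :
    Tendsto (fun n => ‖(inner 𝕜 (v n) (u n) : 𝕜)‖) atTop (𝓝 0) := by
  have hL_lt (j : ℕ) : ∀ᶠ n in atTop, L n < z j := by
    filter_upwards [hz j, ((hg₁ j).const_mul θ).eventually_lt_const (h_lt j)] with n hn h_avg
    by_contra! hzL
    have hu0 : u n ≠ 0 := norm_ne_zero_iff.1 (hu_norm n ▸ one_ne_zero)
    exact (one_le_mul_spectralAverage (hA n) (hu n) hu0 hθ.le hn hzL).not_gt h_avg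
  rw [Metric.tendsto_nhds]
  intro ε hε
  obtain ⟨j, hj⟩ := (h_top.eventually_gt_atTop (1 / (θ * ε) ^ 2)).exists
  filter_upwards [hL_lt j, (hg₂ j).eventually_const_lt hj] with n hLz h_avg
  have h_le := mul_norm_inner_sq_mul_spectralAverage_le (hA n) (hu n) (hL n) hLz
  rw [hu_norm, one_pow] at h_le
  rw [dist_zero_right, norm_norm]
  by_contra! hε_le
  have h_avg_pos : 0 < spectralAverage (hA n) (v n) fun t => 1 / (z j - t) ^ 2 :=
    lt_trans (by positivity) h_avg
  have h_gt : 1 < (θ * ε) ^ 2 * spectralAverage (hA n) (v n) fun t => 1 / (z j - t) ^ 2 := by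
    rwa [div_lt_iff₀' (by positivity)] at h_avg
  have h_mono : (θ * ε) ^ 2 ≤ (θ * ‖(inner 𝕜 (v n) (u n) : 𝕜)‖) ^ 2 := by gcongr
  exact absurd (h_gt.trans_le (mul_le_mul_of_nonneg_right h_mono h_avg_pos.le)) h_le.not_gt

end PerturbedEigenvector

section CauchyTransform

variable {ν : Measure ℝ} {b : ℝ}

section

variable [IsFiniteMeasure ν]

theorem integrable_one_div_sub_pow (hν : ∀ᵐ t ∂ν, t ≤ b) {z : ℝ} (hz : b < z) (m : ℕ) :
    Integrable (fun t => 1 / (z - t) ^ m) ν := by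
  have h_meas : Measurable fun t : ℝ => 1 / (z - t) ^ m := by fun_prop
  refine .of_bound (C := 1 / (z - b) ^ m) h_meas.aestronglyMeasurable ?_
  filter_upwards [hν] with t ht
  have : 0 < z - b := sub_pos.2 hz
  have : 0 < z - t := by linarith
  rw [Real.norm_of_nonneg (by positivity)]
  gcongr

theorem hasDerivAt_cauchyTransform (hν : ∀ᵐ t ∂ν, t ≤ b) {z : ℝ} (hz : b < z) :
    HasDerivAt (cauchyTransform ν) (-∫ t, 1 / (z - t) ^ 2 ∂ν) z := by
  have hd : 0 < (z - b) / 2 := half_pos (sub_pos.2 hz)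
  have h_dist : ∀ᵐ t ∂ν, ∀ x ∈ Set.Ioi ((b + z) / 2), (z - b) / 2 ≤ x - t := by
    filter_upwards [hν] with t ht x hx
    linarith [Set.mem_Ioi.1 hx]
  have h_int := hasDerivAt_integral_of_dominated_loc_of_deriv_le (μ := ν)
    (F := fun x t => 1 / (x - t)) (F' := fun x t => -(1 / (x - t) ^ 2)) (x₀ := z)
    (bound := fun _ => 1 / ((z - b) / 2) ^ 2) (Ioi_mem_nhds (show (b + z) / 2 < z by linarith))
    (Eventually.of_forall fun x => Measurable.aestronglyMeasurable (by fun_prop))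
    (by simpa using integrable_one_div_sub_pow hν hz 1)
    (Measurable.aestronglyMeasurable (by fun_prop))
    (h_dist.mono fun t ht x hx => ?_) (integrable_const _) (h_dist.mono fun t ht x hx => ?_)
  · rw [← integral_neg]
    exact h_int.2
  · rw [norm_neg, Real.norm_of_nonneg (by positivity)]
    gcongr
    exact ht x hx
  · have hxt : x - t ≠ 0 := (hd.trans_le (ht x hx)).ne'
    simpa [neg_div] using ((hasDerivAt_id x).sub_const t).fun_inv hxt

theorem strictAntiOn_cauchyTransform [NeZero ν] (hν : ∀ᵐ t ∂ν, t ≤ b) :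
    StrictAntiOn (cauchyTransform ν) (Set.Ioi b) := by
  refine strictAntiOn_of_deriv_neg (convex_Ioi b)
    (fun z hz => (hasDerivAt_cauchyTransform hν hz).continuousAt.continuousWithinAt) fun z hz => ?_
  rw [interior_Ioi] at hz
  rw [(hasDerivAt_cauchyTransform hν hz).deriv, neg_lt_zero]
  have h_pos : ∀ᵐ t ∂ν, 0 < 1 / (z - t) ^ 2 := by
    filter_upwards [hν] with t ht
    have htz : 0 < z - t := sub_pos.2 (ht.trans_lt hz)
    positivity
  rw [integral_pos_iff_support_of_nonneg_ae (h_pos.mono fun _ h => h.le)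
    (integrable_one_div_sub_pow hν hz 2), pos_iff_ne_zero]
  intro h_null
  obtain ⟨t, ht, ht'⟩ := (h_pos.and (measure_eq_zero_iff_ae_notMem.1 h_null)).exists
  exact ht' ht.ne'

theorem cauchyTransform_lt_of_tendsto_nhdsGT [NeZero ν] (hν : ∀ᵐ t ∂ν, t ≤ b) {g : EReal} {x : ℝ}
    (hg : Tendsto (fun z : ℝ => (cauchyTransform ν z : EReal)) (𝓝[>] b) (𝓝 g))
    (hgx : g ≤ (x : EReal)) {z : ℝ} (hz : b < z) : cauchyTransform ν z < x := by
  obtain ⟨y, hby, hyz⟩ := exists_between hz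
  have h_anti := strictAntiOn_cauchyTransform hν
  have h_le : (cauchyTransform ν y : EReal) ≤ g := by
    refine ge_of_tendsto hg ?_
    filter_upwards [Ioo_mem_nhdsGT hby] with w hw
    exact EReal.coe_le_coe_iff.2 (h_anti hw.1 hby hw.2).le
  exact (h_anti hby hz hyz).trans_le (EReal.coe_le_coe_iff.1 (h_le.trans hgx))

theorem tendsto_integral_one_div_sub_sq_atTop (hν : ∀ᵐ t ∂ν, t ≤ b)
    (h : Tendsto (deriv (cauchyTransform ν)) (𝓝[>] b) atBot) :
    Tendsto (fun z => ∫ t, 1 / (z - t) ^ 2 ∂ν) (𝓝[>] b) atTop := by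
  refine (tendsto_neg_atBot_atTop.comp h).congr' ?_
  filter_upwards [self_mem_nhdsWithin] with z hz
  rw [Function.comp_apply, (hasDerivAt_cauchyTransform hν hz).deriv, neg_neg]

end

theorem nonneg_of_tendsto_cauchyTransform_nhdsGT (hν : ∀ᵐ t ∂ν, t ≤ b) {g : EReal}
    (hg : Tendsto (fun z : ℝ => (cauchyTransform ν z : EReal)) (𝓝[>] b) (𝓝 g)) : 0 ≤ g := by
  refine ge_of_tendsto hg ?_
  filter_upwards [self_mem_nhdsWithin] with z hz
  refine EReal.coe_nonneg.2 (integral_nonneg_of_ae ?_)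
  filter_upwards [hν] with t ht
  exact one_div_nonneg.2 (sub_nonneg.2 (ht.trans (le_of_lt hz)))

theorem cauchyTransform_map_neg (ν : Measure ℝ) :
    cauchyTransform (ν.map Neg.neg) = fun z => -cauchyTransform ν (-z) := by
  funext z
  rw [cauchyTransform, measurableEmbedding_neg.integral_map, cauchyTransform, ← integral_neg]
  congr 1 with t
  rw [← one_div_neg_eq_neg_one_div, neg_sub, sub_neg_eq_add, sub_neg_eq_add, add_comm]

theorem deriv_cauchyTransform_map_neg (ν : Measure ℝ) :
    deriv (cauchyTransform (ν.map Neg.neg)) = fun z => deriv (cauchyTransform ν) (-z) := by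
  funext z
  rw [cauchyTransform_map_neg, deriv.fun_neg, deriv_comp_neg, neg_neg]

theorem ae_map_neg_le {a : ℝ} (hν : ∀ᵐ t ∂ν, a ≤ t) : ∀ᵐ t ∂ν.map Neg.neg, t ≤ -a := by
  rw [ae_map_iff measurable_neg.aemeasurable measurableSet_Iic]
  exact hν.mono fun t ht => neg_le_neg ht

theorem tendsto_neg_nhdsGT_neg (a : ℝ) : Tendsto (fun z : ℝ => -z) (𝓝[>] (-a)) (𝓝[<] a) := by
  simpa using tendsto_neg_nhdsGT (a := -a)

theorem tendsto_cauchyTransform_map_neg {a : ℝ} {g : EReal}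
    (hg : Tendsto (fun z : ℝ => (cauchyTransform ν z : EReal)) (𝓝[<] a) (𝓝 g)) :
    Tendsto (fun z : ℝ => (cauchyTransform (ν.map Neg.neg) z : EReal)) (𝓝[>] (-a)) (𝓝 (-g)) := by
  rw [cauchyTransform_map_neg]
  simp only [EReal.coe_neg]
  exact (continuous_neg.tendsto g).comp (hg.comp (tendsto_neg_nhdsGT_neg a))

theorem nonpos_of_tendsto_cauchyTransform_nhdsLT {a : ℝ} (hν : ∀ᵐ t ∂ν, a ≤ t) {g : EReal}
    (hg : Tendsto (fun z : ℝ => (cauchyTransform ν z : EReal)) (𝓝[<] a) (𝓝 g)) : g ≤ 0 := by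
  simpa using nonneg_of_tendsto_cauchyTransform_nhdsGT (ae_map_neg_le hν)
    (tendsto_cauchyTransform_map_neg hg)

end CauchyTransform

section Edge

theorem exists_boundedContinuousFunction_eq_one_div_sub_pow {b z : ℝ} (hz : b < z) (m : ℕ) :
    ∃ f : BoundedContinuousFunction ℝ ℝ, ∀ t ≤ b, f t = 1 / (z - t) ^ m := by
  have h_pos (t : ℝ) : 0 < max (z - t) (z - b) := lt_max_of_lt_right (sub_pos.2 hz)
  refine ⟨.ofNormedAddCommGroup (fun t => 1 / max (z - t) (z - b) ^ m)
    (continuous_const.div (by fun_prop) fun t => (pow_pos (h_pos t) m).ne')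
    (1 / (z - b) ^ m) fun t => ?_, fun t ht => ?_⟩
  · rw [Real.norm_of_nonneg (one_div_nonneg.2 (pow_pos (h_pos t) m).le)]
    exact one_div_le_one_div_of_le (pow_pos (sub_pos.2 hz) m)
      (pow_le_pow_left₀ (sub_pos.2 hz).le (le_max_right _ _) m)
  · rw [BoundedContinuousFunction.coe_ofNormedAddCommGroup, max_eq_left (by linarith)]

section

variable {𝕜 : Type*} [RCLike 𝕜] {ι : Type*} [Fintype ι] [DecidableEq ι]
  {A : Matrix ι ι 𝕜}

theorem spectralAverage_neg (hA : A.IsHermitian) (v : EuclideanSpace 𝕜 ι) (f : ℝ → ℝ) :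
    spectralAverage hA.neg v f = spectralAverage hA v fun t => f (-t) := by
  have h : (spectralAverage hA.neg v f : 𝕜) = (spectralAverage hA v fun t => f (-t) : ℝ) := by
    have h_cont : ContinuousOn f ((-·) '' spectrum ℝ A) :=
      (A.finite_real_spectrum.image _).continuousOn f
    rw [← trace_cfc_mul_lineProjection, ← trace_cfc_mul_lineProjection, cfc_comp_neg f A h_cont]
  exact_mod_cast h

theorem largestEigenvalue_eq_sSup_spectrum [Nonempty ι] (hA : A.IsHermitian) :
    largestEigenvalue hA = sSup (spectrum ℝ A) := by
  rw [largestEigenvalue, Finset.sup'_univ_eq_ciSup, hA.spectrum_real_eq_range_eigenvalues, iSup]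

theorem smallestEigenvalue_eq_sInf_spectrum [Nonempty ι] (hA : A.IsHermitian) :
    smallestEigenvalue hA = sInf (spectrum ℝ A) := by
  rw [smallestEigenvalue, Finset.inf'_univ_eq_ciInf, hA.spectrum_real_eq_range_eigenvalues, iInf]

theorem largestEigenvalue_neg [Nonempty ι] (hA : A.IsHermitian) :
    largestEigenvalue hA.neg = -smallestEigenvalue hA := by
  rw [largestEigenvalue_eq_sSup_spectrum, smallestEigenvalue_eq_sInf_spectrum, ← spectrum.neg_eq,
    Real.sInf_def, neg_neg]

end

variable {𝕜 : Type*} [RCLike 𝕜] {Ω : Type*} [MeasurableSpace Ω] {Pr : Measure Ω}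
  {ι : ℕ → Type*} [∀ n, Fintype (ι n)] [∀ n, DecidableEq (ι n)] [∀ n, Nonempty (ι n)]
  {A : ∀ n, Ω → Matrix (ι n) (ι n) 𝕜} {v u : ∀ n, Ω → EuclideanSpace 𝕜 (ι n)} {ν : Measure ℝ}

theorem ae_tendsto_spectralAverage_one_div_sub_pow (hA : ∀ n ω, (A n ω).IsHermitian) {b : ℝ}
    (hν : ∀ᵐ t ∂ν, t ≤ b)
    (h_avg : ∀ f : BoundedContinuousFunction ℝ ℝ, ∀ᵐ ω ∂Pr,
      Tendsto (fun n => spectralAverage (hA n ω) (v n ω) f) atTop (𝓝 (∫ t, f t ∂ν)))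
    (h_max : ∀ᵐ ω ∂Pr, Tendsto (fun n => largestEigenvalue (hA n ω)) atTop (𝓝 b)) {z : ℝ}
    (hz : b < z) (m : ℕ) :
    ∀ᵐ ω ∂Pr, Tendsto (fun n => spectralAverage (hA n ω) (v n ω) fun t => 1 / (z - t) ^ m) atTop
      (𝓝 (∫ t, 1 / (z - t) ^ m ∂ν)) := by
  obtain ⟨y, hby, hyz⟩ := exists_between hz
  obtain ⟨f, hf⟩ := exists_boundedContinuousFunction_eq_one_div_sub_pow hyz m
  have h_integral : ∫ t, f t ∂ν = ∫ t, 1 / (z - t) ^ m ∂ν :=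
    integral_congr_ae (hν.mono fun t ht => hf t (ht.trans hby.le))
  rw [← h_integral]
  filter_upwards [h_avg f, h_max] with ω h_avg h_max
  refine h_avg.congr' ?_
  filter_upwards [h_max.eventually_lt_const hby] with n hn
  refine Finset.sum_congr rfl fun i _ => ?_
  rw [hf _ ((Finset.le_sup' _ (Finset.mem_univ i)).trans hn.le)]

theorem ae_tendsto_norm_inner_zero_of_upper_edge [IsProbabilityMeasure ν]
    (hA : ∀ n ω, (A n ω).IsHermitian) {θ b : ℝ} (hθ : 0 < θ) (hν : ∀ᵐ t ∂ν, t ≤ b)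
    (h_avg : ∀ f : BoundedContinuousFunction ℝ ℝ, ∀ᵐ ω ∂Pr,
      Tendsto (fun n => spectralAverage (hA n ω) (v n ω) f) atTop (𝓝 (∫ t, f t ∂ν)))
    (h_max : ∀ᵐ ω ∂Pr, Tendsto (fun n => largestEigenvalue (hA n ω)) atTop (𝓝 b)) {g : EReal}
    (hg : Tendsto (fun z : ℝ => (cauchyTransform ν z : EReal)) (𝓝[>] b) (𝓝 g))
    (hgθ : g ≤ ((1 / θ : ℝ) : EReal))
    (h_slope : Tendsto (deriv (cauchyTransform ν)) (𝓝[>] b) atBot)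
    (hA' : ∀ n ω, (A n ω + (θ : 𝕜) • lineProjection (v n ω)).IsHermitian)
    (hu : ∀ n ω, IsUnitEigenvector (A n ω + (θ : 𝕜) • lineProjection (v n ω))
      (largestEigenvalue (hA' n ω)) (u n ω)) :
    ∀ᵐ ω ∂Pr, Tendsto (fun n => ‖(inner 𝕜 (v n ω) (u n ω) : 𝕜)‖) atTop (𝓝 0) := by
  obtain ⟨z, -, hz, hz_lim⟩ := exists_seq_strictAnti_tendsto_nhdsWithin b
  have h_pow (m : ℕ) := ae_all_iff.2 fun j : ℕ =>
    ae_tendsto_spectralAverage_one_div_sub_pow hA hν h_avg h_max (hz j) m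
  filter_upwards [h_max, h_pow 1, h_pow 2] with ω h_max h_one h_two
  refine tendsto_norm_inner_zero (fun n => hA n ω) hθ (fun n => (hu n ω).1) (fun n => (hu n ω).2)
    (fun n i => eigenvalues_le_largestEigenvalue_add (hA n ω) hθ.le (hA' n ω) i) (fun j => ?_)
    (g₁ := fun j => cauchyTransform ν (z j)) (fun j => by simpa [cauchyTransform] using h_one j)
    h_two (fun j => ?_) ((tendsto_integral_one_div_sub_sq_atTop hν h_slope).comp hz_lim)
  · filter_upwards [h_max.eventually_lt_const (hz j)] with n hn i
    exact (Finset.le_sup' _ (Finset.mem_univ i)).trans_lt hn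
  · rw [← lt_div_iff₀' hθ]
    exact cauchyTransform_lt_of_tendsto_nhdsGT hν hg hgθ (hz j)

theorem ae_tendsto_norm_inner_zero_of_lower_edge [IsProbabilityMeasure ν]
    (hA : ∀ n ω, (A n ω).IsHermitian) {θ a : ℝ} (hθ : θ < 0) (hν : ∀ᵐ t ∂ν, a ≤ t)
    (h_avg : ∀ f : BoundedContinuousFunction ℝ ℝ, ∀ᵐ ω ∂Pr,
      Tendsto (fun n => spectralAverage (hA n ω) (v n ω) f) atTop (𝓝 (∫ t, f t ∂ν)))
    (h_min : ∀ᵐ ω ∂Pr, Tendsto (fun n => smallestEigenvalue (hA n ω)) atTop (𝓝 a)) {g : EReal}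
    (hg : Tendsto (fun z : ℝ => (cauchyTransform ν z : EReal)) (𝓝[<] a) (𝓝 g))
    (hgθ : ((1 / θ : ℝ) : EReal) ≤ g)
    (h_slope : Tendsto (deriv (cauchyTransform ν)) (𝓝[<] a) atBot)
    (hA' : ∀ n ω, (A n ω + (θ : 𝕜) • lineProjection (v n ω)).IsHermitian)
    (hu : ∀ n ω, IsUnitEigenvector (A n ω + (θ : 𝕜) • lineProjection (v n ω))
      (smallestEigenvalue (hA' n ω)) (u n ω)) :
    ∀ᵐ ω ∂Pr, Tendsto (fun n => ‖(inner 𝕜 (v n ω) (u n ω) : 𝕜)‖) atTop (𝓝 0) := by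
  have h_neg (n : ℕ) (ω : Ω) : -(A n ω + (θ : 𝕜) • lineProjection (v n ω)) =
      -A n ω + ((-θ : ℝ) : 𝕜) • lineProjection (v n ω) := by
    rw [neg_add, RCLike.ofReal_neg, neg_smul]
  have hA'_neg (n : ℕ) (ω : Ω) :
      (-A n ω + ((-θ : ℝ) : 𝕜) • lineProjection (v n ω)).IsHermitian := h_neg n ω ▸ (hA' n ω).neg
  have h_largest (n : ℕ) (ω : Ω) :
      largestEigenvalue (hA'_neg n ω) = -smallestEigenvalue (hA' n ω) := by
    rw [← largestEigenvalue_neg]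
    congr 1
    exact (h_neg n ω).symm
  have : IsProbabilityMeasure (ν.map Neg.neg) :=
    Measure.isProbabilityMeasure_map measurable_neg.aemeasurable
  refine ae_tendsto_norm_inner_zero_of_upper_edge (fun n ω => (hA n ω).neg) (neg_pos.2 hθ)
    (ae_map_neg_le hν) (fun f => ?_) (h_min.mono fun ω h => ?_)
    (tendsto_cauchyTransform_map_neg hg) ?_ ?_ hA'_neg fun n ω => ⟨(hu n ω).1, ?_⟩
  · simp only [spectralAverage_neg (hA _ _), measurableEmbedding_neg.integral_map]
    exact h_avg (f.compContinuous ⟨Neg.neg, continuous_neg⟩)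
  · simp only [largestEigenvalue_neg (hA _ ω)]
    exact h.neg
  · rw [one_div_neg_eq_neg_one_div, EReal.coe_neg]
    exact EReal.neg_le_neg_iff.2 hgθ
  · rw [deriv_cauchyTransform_map_neg]
    exact h_slope.comp (tendsto_neg_nhdsGT_neg a)
  · rw [h_largest, ← h_neg, map_neg, LinearMap.neg_apply, (hu n ω).2, RCLike.ofReal_neg, neg_smul]

end Edge

theorem le_one_div_of_notMem_Ioo {θ : ℝ} {x y : EReal} (h : ((1 / θ : ℝ) : EReal) ∉ Set.Ioo x y)
    (hx : x ≤ 0) (hθ : 0 < θ) : y ≤ ((1 / θ : ℝ) : EReal) :=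
  not_lt.1 fun hy => h ⟨hx.trans_lt (EReal.coe_pos.2 (one_div_pos.2 hθ)), hy⟩

theorem one_div_le_of_notMem_Ioo {θ : ℝ} {x y : EReal} (h : ((1 / θ : ℝ) : EReal) ∉ Set.Ioo x y)
    (hy : 0 ≤ y) (hθ : θ < 0) : ((1 / θ : ℝ) : EReal) ≤ x :=
  not_lt.1 fun hx => h ⟨hx, (EReal.coe_neg'.2 (one_div_neg.2 hθ)).trans_le hy⟩

theorem ae_ge_of_isGLB_support {μ : Measure ℝ} {a : ℝ} (ha : IsGLB μ.support a) :
    ∀ᵐ t ∂μ, a ≤ t := by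
  filter_upwards [Measure.support_mem_ae] with t ht using ha.1 ht

theorem ae_le_of_isLUB_support {μ : Measure ℝ} {b : ℝ} (hb : IsLUB μ.support b) :
    ∀ᵐ t ∂μ, t ≤ b := by
  filter_upwards [Measure.support_mem_ae] with t ht using hb.1 ht

end SpikedModel

open SpikedModel in
theorem theorem2p3_general {𝕜 : Type*} [RCLike 𝕜]
    {Ω : Type*} [MeasurableSpace Ω] (Pr : Measure Ω) [IsProbabilityMeasure Pr]
    (X P : ∀ n : ℕ, Ω → Matrix (Fin (n + 1)) (Fin (n + 1)) 𝕜)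
    (hXmeas : ∀ n, Measurable (X n)) (hPmeas : ∀ n, Measurable (P n))
    (hX : ∀ n ω, (X n ω).IsHermitian) (hP : ∀ n ω, (P n ω).IsHermitian)
    (θ : ℝ) (hθ : θ ≠ 0) (μ : ProbabilityMeasure ℝ) (a b : ℝ)
    (ha : θ < 0 → ∀ᵐ t ∂(μ : Measure ℝ), a ≤ t) (hb : 0 < θ → ∀ᵐ t ∂(μ : Measure ℝ), t ≤ b)
    (hesd : ∀ᵐ ω ∂Pr, Tendsto (fun n => empiricalSpectralMeasure (hX n ω)) atTop (𝓝 μ))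
    (hmin : θ < 0 → ∀ᵐ ω ∂Pr, Tendsto (fun n => smallestEigenvalue (hX n ω)) atTop (𝓝 a))
    (hmax : 0 < θ → ∀ᵐ ω ∂Pr, Tendsto (fun n => largestEigenvalue (hX n ω)) atTop (𝓝 b))
    (hrank : ∀ n ω, (P n ω).rank = 1)
    (heig : ∀ n ω, Module.End.HasEigenvalue (Matrix.toLin' (P n ω)) (θ : 𝕜))
    (hindep : ∀ n, IndepFun (X n) (P n) Pr)
    (hinv : ∀ n, IsConjInvariant Pr (X n) ∨ IsConjInvariant Pr (P n))
    (Ga Gb : EReal)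
    (hGa : θ < 0 → Tendsto (fun z : ℝ => (cauchyTransform μ z : EReal)) (𝓝[<] a) (𝓝 Ga))
    (hGb : 0 < θ → Tendsto (fun z : ℝ => (cauchyTransform μ z : EReal)) (𝓝[>] b) (𝓝 Gb))
    (hsub_neg : θ < 0 → ((1 / θ : ℝ) : EReal) ≤ Ga) (hsub_pos : 0 < θ → Gb ≤ ((1 / θ : ℝ) : EReal))
    (hslope_pos : 0 < θ → Tendsto (deriv (cauchyTransform μ)) (𝓝[>] b) atBot)
    (hslope_neg : θ < 0 → Tendsto (deriv (cauchyTransform μ)) (𝓝[<] a) atBot)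
    (u : ∀ n : ℕ, Ω → EuclideanSpace 𝕜 (Fin (n + 1)))
    (hu_pos : 0 < θ → ∀ n ω, IsUnitEigenvector (X n ω + P n ω)
      (largestEigenvalue ((hX n ω).add (hP n ω))) (u n ω))
    (hu_neg : θ < 0 → ∀ n ω, IsUnitEigenvector (X n ω + P n ω)
      (smallestEigenvalue ((hX n ω).add (hP n ω))) (u n ω)) :
    ∀ᵐ ω ∂Pr, Tendsto (fun n => projNorm (u n ω) (kerSub θ (P n ω))) atTop (𝓝 0) := by
  choose v hv hPv using fun n ω =>
    exists_eq_smul_lineProjection (hP n ω) (hrank n ω) hθ (heig n ω)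
  have h_avg := ae_tendsto_spectralAverage hXmeas hPmeas hX hθ hv hPv hindep hinv hesd
  obtain rfl : P = fun n ω => (θ : 𝕜) • lineProjection (v n ω) := by
    funext n ω
    exact hPv n ω
  simp only [projNorm_kerSub_smul_lineProjection hθ (hv _ _)]
  rcases hθ.lt_or_gt with hneg | hpos
  · exact ae_tendsto_norm_inner_zero_of_lower_edge hX hneg (ha hneg) h_avg (hmin hneg) (hGa hneg)
      (hsub_neg hneg) (hslope_neg hneg) _ (hu_neg hneg)
  · exact ae_tendsto_norm_inner_zero_of_upper_edge hX hpos (hb hpos) h_avg (hmax hpos) (hGb hpos)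
      (hsub_pos hpos) (hslope_pos hpos) _ (hu_pos hpos)

/-- `X n` and `P n` are the matrices of size `n + 1`, so that all sizes `1, 2, 3, …` occur.  `𝕜` is
`ℝ` (symmetric matrices, orthogonal group) or `ℂ` (Hermitian matrices, unitary group).  `Ga` and
`Gb` are the one-sided limits of the Cauchy transform at the edges, which always exist in
`[-∞, ∞]` by monotonicity. -/
theorem theorem2p3 {𝕜 : Type*} [RCLike 𝕜]
    {Ω : Type*} [MeasurableSpace Ω] (Pr : Measure Ω) [IsProbabilityMeasure Pr]
    (X P : ∀ n : ℕ, Ω → Matrix (Fin (n + 1)) (Fin (n + 1)) 𝕜)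
    (hXmeas : ∀ n, Measurable (X n)) (hPmeas : ∀ n, Measurable (P n))
    (hX : ∀ n ω, (X n ω).IsHermitian) (hP : ∀ n ω, (P n ω).IsHermitian)
    -- the limiting eigenvalue distribution and its edges
    (μ : ProbabilityMeasure ℝ) (hμ : IsCompact (μ : Measure ℝ).support)
    (a b : ℝ) (ha : IsGLB (μ : Measure ℝ).support a) (hb : IsLUB (μ : Measure ℝ).support b)
    (hesd : ∀ᵐ ω ∂Pr, Tendsto (fun n => SpikedModel.empiricalSpectralMeasure (hX n ω)) atTop (𝓝 μ))
    (hmin : ∀ᵐ ω ∂Pr, Tendsto (fun n => SpikedModel.smallestEigenvalue (hX n ω)) atTop (𝓝 a))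
    (hmax : ∀ᵐ ω ∂Pr, Tendsto (fun n => SpikedModel.largestEigenvalue (hX n ω)) atTop (𝓝 b))
    -- the perturbation has rank one, with sole non-zero eigenvalue `θ`
    (θ : ℝ) (hθ : θ ≠ 0)
    (hrank : ∀ n ω, (P n ω).rank = 1)
    (heig : ∀ n ω, Module.End.HasEigenvalue (Matrix.toLin' (P n ω)) (θ : 𝕜))
    (hindep : ∀ n, IndepFun (X n) (P n) Pr)
    (hinv : ∀ n, SpikedModel.IsConjInvariant Pr (X n) ∨ SpikedModel.IsConjInvariant Pr (P n))
    -- the subcritical condition and the infinite slope at the relevant edge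
    (Ga Gb : EReal)
    (hGa : Tendsto (fun z : ℝ => (SpikedModel.cauchyTransform μ z : EReal)) (𝓝[<] a) (𝓝 Ga))
    (hGb : Tendsto (fun z : ℝ => (SpikedModel.cauchyTransform μ z : EReal)) (𝓝[>] b) (𝓝 Gb))
    (hsub : ((1 / θ : ℝ) : EReal) ∉ Set.Ioo Ga Gb)
    (hslope_pos : 0 < θ → Tendsto (deriv (SpikedModel.cauchyTransform μ)) (𝓝[>] b) atBot)
    (hslope_neg : θ < 0 → Tendsto (deriv (SpikedModel.cauchyTransform μ)) (𝓝[<] a) atBot)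
    -- a unit eigenvector of `X + P` for its largest or smallest eigenvalue
    (u : ∀ n : ℕ, Ω → EuclideanSpace 𝕜 (Fin (n + 1)))
    (hu_pos : 0 < θ → ∀ n ω, SpikedModel.IsUnitEigenvector (X n ω + P n ω)
      (SpikedModel.largestEigenvalue ((hX n ω).add (hP n ω))) (u n ω))
    (hu_neg : θ < 0 → ∀ n ω, SpikedModel.IsUnitEigenvector (X n ω + P n ω)
      (SpikedModel.smallestEigenvalue ((hX n ω).add (hP n ω))) (u n ω)) :
    ∀ᵐ ω ∂Pr, Tendsto (fun n => SpikedModel.projNorm (u n ω) (SpikedModel.kerSub θ (P n ω)))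
      atTop (𝓝 0) := by
  have ha' := SpikedModel.ae_ge_of_isGLB_support ha
  have hb' := SpikedModel.ae_le_of_isLUB_support hb
  exact theorem2p3_general Pr X P hXmeas hPmeas hX hP θ hθ μ a b
    (fun _ => ha') (fun _ => hb') hesd (fun _ => hmin) (fun _ => hmax) hrank heig hindep hinv Ga Gb
    (fun _ => hGa) (fun _ => hGb)
    (SpikedModel.one_div_le_of_notMem_Ioo hsub
      (SpikedModel.nonneg_of_tendsto_cauchyTransform_nhdsGT hb' hGb))
    (SpikedModel.le_one_div_of_notMem_Ioo hsub
      (SpikedModel.nonpos_of_tendsto_cauchyTransform_nhdsLT ha' hGa))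
    hslope_pos hslope_neg u hu_pos hu_neg
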